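/- A closed hyperbolic surface is a compact quotient $X=\Gamma\backslash\mathbb H$ of the hyperbolic plane by a subgroup $\Gamma\le \mathrm{PSL}_2(\mathbb R)$ acting freely and properly discontinuously, with the induced metric and area $\operatorname{vol}$. For $R>0$ let $N_s(X,R)$ be the number of (unoriented) simple closed geodesics on $X$ of length $\le R$, and let $$X_{<R}=\{p\in X : \operatorname{InjRad}(p)<R\},\qquad \operatorname{InjRad}(p)=\sup\{r : \exp_p \text{ is injective on } B_r(0)\subseteq T_pX\}.$$ \textbf{Proposition.} Let $(X_n)_{n\in\mathbb N}$ be a sequence of closed hyperbolic surfaces. If for every $R>0$ $$\frac{N_s(X_n,R)}{\operatorname{vol}(X_n)}\xrightarrow[n\to\infty]{}0,$$ then $(X_n)_{n\in\mathbb N}$ is Benjamini--Schramm convergent to $\mathbb H$, that is, for every $R>0$ $$\frac{\operatorname{vol}\big((X_n)_{<R}\big)}{\operatorname{vol}(X_n)}\xrightarrow[n\to\infty]{}0.$$ -/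

import Mathlib

open MeasureTheory Filter Topology
open scoped UpperHalfPlane MatrixGroups ENNReal NNReal

noncomputable section

namespace HyperbolicSurface

/-- The centre of `SL(2, ℝ)` acts trivially on the upper half-plane. -/
theorem center_smul {g : SL(2, ℝ)} (hg : g ∈ Subgroup.center SL(2, ℝ)) (z : ℍ) : g • z = z := by
  have h := Matrix.SpecialLinearGroup.scalar_eq_self_of_mem_center hg 0
  have h01 : g 0 1 = 0 := by
    have := congrFun (congrFun h 0) 1
    simpa using this.symm
  have h10 : g 1 0 = 0 := by
    have := congrFun (congrFun h 1) 0
    simpa using this.symm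
  have h11 : g 1 1 = g 0 0 := by
    have := congrFun (congrFun h 1) 1
    simpa using this.symm
  have hdet : g 0 0 * g 0 0 = 1 := by
    have := g.det_coe
    rw [Matrix.det_fin_two, h01, h10, h11] at this
    simpa using this
  have h00 : ((g 0 0 : ℝ) : ℂ) ≠ 0 := by
    intro h0
    have h0' : g 0 0 = 0 := by exact_mod_cast h0
    rw [h0'] at hdet
    norm_num at hdet
  apply UpperHalfPlane.ext
  rw [UpperHalfPlane.coe_specialLinearGroup_apply]
  simp only [h01, h10, h11, Algebra.algebraMap_self, RingHom.id_apply, Complex.ofReal_zero,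
    add_zero, zero_mul, zero_add]
  field_simp

/-- The action of `PSL(2, ℝ)` on the upper half-plane by Möbius transformations. -/
def pslToPerm : PSL(2, ℝ) →* Equiv.Perm ℍ :=
  QuotientGroup.lift (Subgroup.center SL(2, ℝ)) (MulAction.toPermHom SL(2, ℝ) ℍ)
    fun _ hg => Equiv.ext fun z => center_smul hg z

instance pslAction : MulAction PSL(2, ℝ) ℍ := MulAction.compHom ℍ pslToPerm

theorem psl_mk_smul (g : SL(2, ℝ)) (z : ℍ) : (QuotientGroup.mk g : PSL(2, ℝ)) • z = g • z := rfl

/-- The point `ζ = -i tanh(|v| / (2 Im z)) v / |v|` of the unit disc (`0` if `v = 0`). -/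
def discPoint (z : ℍ) (v : ℂ) : ℂ :=
  -Complex.I * ((Real.tanh (‖v‖ / (2 * z.im)) : ℝ) : ℂ) * (v / (‖v‖ : ℂ))

theorem norm_discPoint_lt_one (z : ℍ) (v : ℂ) : ‖discPoint z v‖ < 1 := by
  have h1 : ‖v / (‖v‖ : ℂ)‖ ≤ 1 := by
    rw [norm_div, Complex.norm_real, norm_norm]
    exact div_self_le_one _
  have h2 : |Real.tanh (‖v‖ / (2 * z.im))| < 1 := Real.abs_tanh_lt_one _
  unfold discPoint
  rw [norm_mul, norm_mul, norm_neg, Complex.norm_I, one_mul, Complex.norm_real, Real.norm_eq_abs]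
  calc _ ≤ |Real.tanh (‖v‖ / (2 * z.im))| * 1 := by gcongr
    _ < 1 := by rwa [mul_one]

theorem im_cayley_pos {ζ : ℂ} (h : ‖ζ‖ < 1) : 0 < (Complex.I * (1 + ζ) / (1 - ζ)).im := by
  have hne : 1 - ζ ≠ 0 := by
    intro h0
    rw [← sub_eq_zero.mp h0] at h
    simp at h
  have hpos : 0 < Complex.normSq (1 - ζ) := Complex.normSq_pos.mpr hne
  have hsq : ζ.re * ζ.re + ζ.im * ζ.im < 1 := by
    rw [← Complex.normSq_apply, Complex.normSq_eq_norm_sq]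
    nlinarith [norm_nonneg ζ]
  rw [Complex.div_im, ← sub_div]
  apply div_pos _ hpos
  simp
  nlinarith

theorem im_exp_pos (z : ℍ) (v : ℂ) :
    0 < ((z.re : ℂ) + (z.im : ℂ) *
      (Complex.I * (1 + discPoint z v) / (1 - discPoint z v))).im := by
  rw [Complex.add_im, Complex.ofReal_im, Complex.im_ofReal_mul, zero_add]
  exact mul_pos z.im_pos (im_cayley_pos (norm_discPoint_lt_one z v))

/-- The Riemannian exponential map `exp_z : T_z ℍ → ℍ` of the hyperbolic plane. The tangent space
at `z` is `ℂ`, with the norm `|v| / Im z` of the metric `(dx² + dy²) / y²`.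
In the unit disc the geodesic of initial unit direction `u` at `0` is `r ↦ tanh(r / 2) u`;
the Cayley transform `ζ ↦ i (1 + ζ) / (1 - ζ)` carries it (its differential at `0` being
multiplication by `2i`) to a geodesic at `i`, and `w ↦ Re z + (Im z) w` carries that one to `z`. -/
def hexp (z : ℍ) (v : ℂ) : ℍ :=
  ⟨(z.re : ℂ) + (z.im : ℂ) * (Complex.I * (1 + discPoint z v) / (1 - discPoint z v)),
    im_exp_pos z v⟩

/-- The open ball of radius `r` about the origin of the tangent space `T_z ℍ`. -/
def tangentBall (z : ℍ) (r : ℝ) : Set ℂ := {v | ‖v‖ / z.im < r}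

end HyperbolicSurface

open HyperbolicSurface

/-- A closed hyperbolic surface `Γ \ ℍ`: the compact quotient of the hyperbolic plane by a group
`Γ` of orientation-preserving isometries that acts freely and properly discontinuously. -/
structure ClosedHyperbolicSurface where
  /-- The Fuchsian group. -/
  Γ : Subgroup PSL(2, ℝ)
  properlyDiscontinuous : ProperlyDiscontinuousSMul Γ ℍ
  free : ∀ γ ∈ Γ, ∀ z : ℍ, γ • z = z → γ = 1
  compact : CompactSpace (MulAction.orbitRel.Quotient Γ ℍ)

namespace ClosedHyperbolicSurface

variable (X : ClosedHyperbolicSurface)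

/-- The points of the surface. -/
abbrev Point : Type := MulAction.orbitRel.Quotient X.Γ ℍ

/-- The universal covering `ℍ → Γ \ ℍ`. -/
def proj (z : ℍ) : X.Point := Quotient.mk _ z

/-- The Dirichlet fundamental domain of `Γ` centred at `i`. -/
def dirichletDomain : Set ℍ :=
  {z | ∀ γ ∈ X.Γ, dist z UpperHalfPlane.I ≤ dist z (γ • UpperHalfPlane.I)}

/-- The hyperbolic area of a subset of the surface. -/
def vol (A : Set X.Point) : ℝ≥0∞ := volume (X.dirichletDomain ∩ X.proj ⁻¹' A)

/-- `InjRad(p)`, the supremum of the radii `r` such that `exp_p` is injective on the ball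
`B_r(0) ⊆ T_p X`. As the covering is a local isometry, `T_p X` is `T_z ℍ` and `exp_p` is
`exp_z` followed by the covering, for any point `z` above `p`. -/
def injRad (p : X.Point) : ℝ≥0∞ :=
  ⨆ (r : ℝ≥0) (_ : ∃ z : ℍ, X.proj z = p ∧
    Set.InjOn (fun v => X.proj (hexp z v)) (tangentBall z r)), (r : ℝ≥0∞)

/-- The `R`-thin part of the surface. -/
def thinPart (R : ℝ) : Set X.Point := {p | X.injRad p < ENNReal.ofReal R}

/-- `A` is (the trace of) a simple closed geodesic of length `L`. The complete unit speed geodesics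
of the surface are the projections of those of `ℍ`, which are the isometric embeddings of `ℝ`.
Such a geodesic is closed of length `L` if it is `L`-periodic, and simple if it has no
self-intersection within a period. -/
def IsSimpleClosedGeodesic (A : Set X.Point) (L : ℝ) : Prop :=
  0 < L ∧ ∃ c : ℝ → ℍ, Isometry c ∧ (∀ t, X.proj (c (t + L)) = X.proj (c t)) ∧
    Set.InjOn (fun t => X.proj (c t)) (Set.Ico 0 L) ∧ A = Set.range fun t => X.proj (c t)

/-- The number `N_s(X, R)` of simple closed geodesics of length at most `R`, unoriented and up to
reparametrization, that is, counted by their traces. -/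
def numSimpleClosedGeodesics (R : ℝ) : ℕ∞ :=
  {A : Set X.Point | ∃ L ≤ R, X.IsSimpleClosedGeodesic A L}.encard

end ClosedHyperbolicSurface

/-- Benjamini–Schramm convergence of a sequence of closed hyperbolic surfaces to `ℍ`. -/
def BenjaminiSchrammConvergent (X : ℕ → ClosedHyperbolicSurface) : Prop :=
  ∀ R : ℝ, 0 < R →
    Tendsto (fun n => (X n).vol ((X n).thinPart R) / (X n).vol Set.univ) atTop (𝓝 0)

end

/-!
Through every point `z` of the `R`-thin part passes a noncontractible geodesic loop of length less
than `2 * R`. A shortest one is the projection of the segment from `z` to `γ • z` for a hyperbolic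
`γ ∈ Γ`. The closed geodesic freely homotopic to it is simple: if a translate of the axis of `γ`
crossed the axis, the broken geodesic through the orbit of `z` under `γ` would meet its own
translate, and cutting and pasting the loop at the intersection would produce a shorter one.

In Fermi coordinates about the axis, a loop of length less than `2 * R` around a closed geodesic of
length `l` starts at a point whose distance `r` from the geodesic satisfies
`cosh r * sinh (l / 2) < sinh R`. Such points fill an area of order `sinh R`, whatever the value of
`l`. Hence the area of the `R`-thin part is at most a constant depending on `R` times the number of
simple closed geodesics of length at most `2 * R`.
-/

noncomputable section

namespace HyperbolicSurface

open Real (sinh cosh tanh arsinh exp log)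

/-- Fermi coordinates about the imaginary axis: the point at signed distance `s` from the axis whose
orthogonal projection to the axis is `exp t * I`. -/
def fermi (t s : ℝ) : ℍ :=
  ⟨⟨exp t * tanh s, exp t / cosh s⟩, div_pos (Real.exp_pos t) (Real.cosh_pos s)⟩

/-- The first Fermi coordinate: the foot of the perpendicular to the imaginary axis. -/
def foot (z : ℍ) : ℝ := log ‖(z : ℂ)‖

/-- The second Fermi coordinate: the signed distance to the imaginary axis. -/
def height (z : ℍ) : ℝ := arsinh (z.re / z.im)

@[simp] theorem re_fermi (t s : ℝ) : (fermi t s).re = exp t * tanh s := rfl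

@[simp] theorem im_fermi (t s : ℝ) : (fermi t s).im = exp t / cosh s := rfl

theorem normSq_fermi (t s : ℝ) : Complex.normSq (fermi t s) = exp t ^ 2 := by
  have hs := (Real.cosh_pos s).ne'
  rw [Complex.normSq_apply, UpperHalfPlane.coe_re, UpperHalfPlane.coe_im, re_fermi, im_fermi,
    Real.tanh_eq_sinh_div_cosh]
  field_simp
  linarith [Real.cosh_sq s]

theorem norm_fermi (t s : ℝ) : ‖(fermi t s : ℂ)‖ = exp t := by
  rw [← sq_eq_sq₀ (norm_nonneg _) (Real.exp_pos t).le, ← Complex.normSq_eq_norm_sq, normSq_fermi]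

@[simp] theorem foot_fermi (t s : ℝ) : foot (fermi t s) = t := by
  rw [foot, norm_fermi, Real.log_exp]

@[simp] theorem height_fermi (t s : ℝ) : height (fermi t s) = s := by
  have hs := (Real.cosh_pos s).ne'
  rw [height, re_fermi, im_fermi, Real.tanh_eq_sinh_div_cosh, ← Real.arsinh_sinh s]
  congr 1
  rw [Real.arsinh_sinh]
  field_simp

theorem fermi_foot_height (z : ℍ) : fermi (foot z) (height z) = z := by
  have hz := z.im_pos
  have hne : 0 < ‖(z : ℂ)‖ := norm_pos_iff.2 z.ne_zero
  have hnorm : exp (foot z) = ‖(z : ℂ)‖ := Real.exp_log hne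
  have hcosh : cosh (height z) = ‖(z : ℂ)‖ / z.im := by
    rw [height, Real.cosh_arsinh, Real.sqrt_eq_iff_mul_self_eq (by positivity) (by positivity),
      ← sq, div_pow, div_pow, ← Complex.normSq_eq_norm_sq, Complex.normSq_apply,
      UpperHalfPlane.coe_re, UpperHalfPlane.coe_im]
    field_simp
    ring
  apply UpperHalfPlane.ext
  apply Complex.ext
  · change exp (foot z) * tanh (height z) = z.re
    rw [Real.tanh_eq_sinh_div_cosh, hcosh, hnorm, height, Real.sinh_arsinh]
    field_simp
  · change exp (foot z) / cosh (height z) = z.im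
    rw [hcosh, hnorm]
    field_simp

theorem continuous_foot : Continuous foot :=
  UpperHalfPlane.continuous_coe.norm.log fun z => norm_ne_zero_iff.2 z.ne_zero

theorem continuous_height : Continuous height :=
  Real.continuous_arsinh.comp
    (UpperHalfPlane.continuous_re.div UpperHalfPlane.continuous_im fun z => z.im_ne_zero)

theorem continuous_fermi {α : Type*} [TopologicalSpace α] {t s : α → ℝ} (ht : Continuous t)
    (hs : Continuous s) : Continuous fun x => fermi (t x) (s x) := by
  have hcosh (x) : cosh (s x) ≠ 0 := (Real.cosh_pos _).ne'
  refine Continuous.upperHalfPlaneMk ?_ _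
  simp only [Complex.mk_eq_add_mul_I, Real.tanh_eq_sinh_div_cosh]
  fun_prop (disch := exact hcosh)

theorem cosh_dist_fermi (t₁ s₁ t₂ s₂ : ℝ) : cosh (dist (fermi t₁ s₁) (fermi t₂ s₂)) =
    cosh s₁ * cosh s₂ * cosh (t₁ - t₂) - sinh s₁ * sinh s₂ := by
  have h₁ := (Real.cosh_pos s₁).ne'
  have h₂ := (Real.cosh_pos s₂).ne'
  rw [UpperHalfPlane.cosh_dist', re_fermi, im_fermi, re_fermi, im_fermi,
    Real.tanh_eq_sinh_div_cosh, Real.tanh_eq_sinh_div_cosh, Real.cosh_eq (t₁ - t₂), neg_sub,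
    Real.exp_sub, Real.exp_sub]
  field_simp
  linear_combination
    -exp t₁ ^ 2 * cosh s₂ ^ 2 * Real.cosh_sq s₁ - exp t₂ ^ 2 * cosh s₁ ^ 2 * Real.cosh_sq s₂

theorem dist_eq_abs_of_cosh_dist_eq {α : Type*} [PseudoMetricSpace α] {x y : α} {u : ℝ}
    (h : cosh (dist x y) = cosh u) : dist x y = |u| := by
  rw [← Real.cosh_abs u] at h
  exact Real.cosh_strictMonoOn.injOn dist_nonneg (abs_nonneg u) h

theorem isometry_fermi_zero : Isometry fun t => fermi t 0 :=
  Isometry.of_dist_eq fun t₁ t₂ => dist_eq_abs_of_cosh_dist_eq (by simp [cosh_dist_fermi])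

/-- The point with Fermi coordinates `t`, `s` lies on the geodesic that is symmetric about the
perpendicular to the axis at `t = 0` and crosses it at height `artanh κ`. -/
def OnGeodesic (κ t s : ℝ) : Prop := sinh s = κ * (cosh s * cosh t)

/-- The signed distance of `fermi t s` from the perpendicular to the axis at `t = 0`, which is an
arclength parameter on each of the geodesics of `OnGeodesic`. -/
def arclength (t s : ℝ) : ℝ := arsinh (cosh s * sinh t)

@[simp] theorem sinh_arclength (t s : ℝ) : sinh (arclength t s) = cosh s * sinh t :=
  Real.sinh_arsinh _

namespace OnGeodesic

variable {κ t s t₁ s₁ t₂ s₂ t₃ s₃ : ℝ}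

theorem one_sub_sq_mul (h : OnGeodesic κ t s) :
    (1 - κ ^ 2) * (cosh s * cosh t) ^ 2 = 1 + (cosh s * sinh t) ^ 2 := by
  rw [OnGeodesic] at h
  linear_combination (sinh s + κ * (cosh s * cosh t)) * h + Real.cosh_sq s
    + cosh s ^ 2 * Real.cosh_sq t

theorem one_sub_sq_pos (h : OnGeodesic κ t s) : 0 < 1 - κ ^ 2 :=
  pos_of_mul_pos_left (h.one_sub_sq_mul ▸ by positivity) (sq_nonneg (cosh s * cosh t))

theorem cosh_arclength (h : OnGeodesic κ t s) :
    cosh (arclength t s) = √(1 - κ ^ 2) * (cosh s * cosh t) := by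
  have hpos : 0 < cosh s * cosh t := mul_pos (Real.cosh_pos s) (Real.cosh_pos t)
  rw [arclength, Real.cosh_arsinh, ← h.one_sub_sq_mul, Real.sqrt_mul' _ (sq_nonneg _),
    Real.sqrt_sq hpos.le]

theorem dist_eq (h₁ : OnGeodesic κ t₁ s₁) (h₂ : OnGeodesic κ t₂ s₂) :
    dist (fermi t₁ s₁) (fermi t₂ s₂) = |arclength t₁ s₁ - arclength t₂ s₂| := by
  have hκ := Real.sq_sqrt h₁.one_sub_sq_pos.le
  refine dist_eq_abs_of_cosh_dist_eq ?_
  rw [Real.cosh_sub, h₁.cosh_arclength, h₂.cosh_arclength, sinh_arclength, sinh_arclength,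
    cosh_dist_fermi, Real.cosh_sub, h₁, h₂]
  linear_combination (-cosh s₁ * cosh t₁ * (cosh s₂ * cosh t₂)) * hκ

theorem arclength_le (h₁ : OnGeodesic κ t₁ s₁) (h₂ : OnGeodesic κ t₂ s₂) (ht : t₁ ≤ t₂) :
    arclength t₁ s₁ ≤ arclength t₂ s₂ := by
  have h : 0 ≤ sinh (t₂ - t₁) := Real.sinh_nonneg_iff.2 (sub_nonneg.2 ht)
  rw [← sub_nonneg, ← Real.sinh_nonneg_iff]
  calc 0 ≤ √(1 - κ ^ 2) * (cosh s₁ * cosh s₂) * sinh (t₂ - t₁) := by positivity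
    _ = _ := by
      rw [Real.sinh_sub, Real.sinh_sub, h₁.cosh_arclength, h₂.cosh_arclength, sinh_arclength,
        sinh_arclength]
      ring

theorem dist_add_dist (h₁ : OnGeodesic κ t₁ s₁) (h₂ : OnGeodesic κ t₂ s₂)
    (h₃ : OnGeodesic κ t₃ s₃) (h₁₂ : t₁ ≤ t₂) (h₂₃ : t₂ ≤ t₃) :
    dist (fermi t₁ s₁) (fermi t₂ s₂) + dist (fermi t₂ s₂) (fermi t₃ s₃) =
      dist (fermi t₁ s₁) (fermi t₃ s₃) := by
  have h := h₁.arclength_le h₂ h₁₂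
  have h' := h₂.arclength_le h₃ h₂₃
  rw [h₁.dist_eq h₂, h₂.dist_eq h₃, h₁.dist_eq h₃, abs_of_nonpos (sub_nonpos.2 h),
    abs_of_nonpos (sub_nonpos.2 h'), abs_of_nonpos (sub_nonpos.2 (h.trans h'))]
  ring

end OnGeodesic

theorem foot_eq_of_dist_eq {t s t₀ s₀ : ℝ} (ht₀ : t₀ ≠ 0)
    (h : dist (fermi (-t₀) s₀) (fermi t s) = dist (fermi t s) (fermi t₀ s₀)) : t = 0 := by
  have hcosh := congrArg cosh h
  rw [cosh_dist_fermi, cosh_dist_fermi, Real.cosh_sub, Real.cosh_sub, Real.cosh_neg,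
    Real.sinh_neg] at hcosh
  have hprod : cosh s₀ * cosh s * (sinh t₀ * sinh t) = 0 := by linear_combination hcosh / 2
  simpa [(Real.cosh_pos _).ne', ht₀] using hprod

theorem continuousOn_artanh : ContinuousOn Real.artanh (Set.Ioo (-1) 1) := by
  intro x hx
  have hnum : 1 + x ≠ 0 := by linarith [hx.1]
  have hden : 1 - x ≠ 0 := by linarith [hx.2]
  have hsqrt : √((1 + x) / (1 - x)) ≠ 0 :=
    (Real.sqrt_pos.2 (div_pos (by linarith [hx.1]) (by linarith [hx.2]))).ne'
  unfold Real.artanh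
  fun_prop (disch := assumption)

/-- The height, over the foot `x`, of the broken geodesic through the points
`fermi ((k + 1 / 2) * l) s₀`. It is periodic, hence a function on `AddCircle l`, where the norm of
`x` is the distance to the nearest midpoint between two vertices. -/
def brokenGeodesic (l s₀ : ℝ) (x : AddCircle l) : ℝ :=
  Real.artanh (tanh s₀ * (cosh ‖x‖ / cosh (l / 2)))

section BrokenGeodesic

variable {l : ℝ} (s₀ : ℝ)

theorem tanh_mul_cosh_norm_div_mem_Ioo (hl : l ≠ 0) (x : AddCircle l) :
    tanh s₀ * (cosh ‖x‖ / cosh (l / 2)) ∈ Set.Ioo (-1) 1 := by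
  have hx : cosh ‖x‖ / cosh (l / 2) ≤ 1 := by
    refine (div_le_one (Real.cosh_pos _)).2 (Real.cosh_le_cosh.2 ?_)
    simpa [abs_div] using AddCircle.norm_le_half_period l hl
  rw [Set.mem_Ioo, ← abs_lt, abs_mul, abs_of_pos (show 0 < cosh ‖x‖ / cosh (l / 2) by positivity)]
  exact (mul_le_of_le_one_right (abs_nonneg _) hx).trans_lt (Real.abs_tanh_lt_one s₀)

theorem continuous_brokenGeodesic (hl : l ≠ 0) : Continuous (brokenGeodesic l s₀) :=
  continuousOn_artanh.comp_continuous (by fun_prop) (tanh_mul_cosh_norm_div_mem_Ioo s₀ hl)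

theorem onGeodesic_brokenGeodesic (hl : l ≠ 0) {t : ℝ} (ht : |t| ≤ |l| / 2) :
    OnGeodesic (tanh s₀ / cosh (l / 2)) t (brokenGeodesic l s₀ t) := by
  have htanh := Real.tanh_artanh (tanh_mul_cosh_norm_div_mem_Ioo s₀ hl t)
  rw [← brokenGeodesic, (AddCircle.norm_coe_eq_abs_iff l hl).2 ht, Real.cosh_abs,
    Real.tanh_eq_sinh_div_cosh, div_eq_iff (Real.cosh_pos _).ne'] at htanh
  rw [OnGeodesic, htanh]
  ring

theorem onGeodesic_vertex {t : ℝ} (ht : |t| = |l| / 2) :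
    OnGeodesic (tanh s₀ / cosh (l / 2)) t s₀ := by
  have hcosh : cosh t = cosh (l / 2) := by
    rw [← Real.cosh_abs t, ht, ← Real.cosh_abs (l / 2), abs_div, abs_two]
  have := (Real.cosh_pos s₀).ne'
  have := (Real.cosh_pos (l / 2)).ne'
  rw [OnGeodesic, hcosh, Real.tanh_eq_sinh_div_cosh]
  field_simp

theorem dist_add_dist_brokenGeodesic (hl : 0 < l) {t : ℝ} (ht : |t| ≤ l / 2) :
    dist (fermi (-(l / 2)) s₀) (fermi t (brokenGeodesic l s₀ t)) +
      dist (fermi t (brokenGeodesic l s₀ t)) (fermi (l / 2) s₀) =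
        dist (fermi (-(l / 2)) s₀) (fermi (l / 2) s₀) := by
  have habs : |l| / 2 = l / 2 := by rw [abs_of_pos hl]
  refine OnGeodesic.dist_add_dist (onGeodesic_vertex s₀ ?_)
    (onGeodesic_brokenGeodesic s₀ hl.ne' (habs ▸ ht)) (onGeodesic_vertex s₀ ?_)
    (neg_le_of_abs_le ht) (le_of_abs_le ht)
  · rw [abs_neg, abs_div, abs_two]
  · rw [abs_div, abs_two]

end BrokenGeodesic

instance : IsIsometricSMul PSL(2, ℝ) ℍ where
  isometry_smul γ := by
    induction γ using QuotientGroup.induction_on with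
    | H g => exact isometry_smul ℍ g

theorem det_eq_one (g : SL(2, ℝ)) : g 0 0 * g 1 1 - g 0 1 * g 1 0 = 1 := by
  rw [← Matrix.det_fin_two, g.det_coe]

theorem re_div_im_smul (g : SL(2, ℝ)) (z : ℍ) : (g • z).re / (g • z).im =
    (g 0 0 * g 1 0 * Complex.normSq z + (g 0 0 * g 1 1 + g 0 1 * g 1 0) * z.re + g 0 1 * g 1 1)
      / z.im := by
  have hdenom : 0 < Complex.normSq ((g 1 0 : ℂ) * z + g 1 1) :=
    Complex.normSq_pos.2 (UpperHalfPlane.denom_ne_zero (g : GL (Fin 2) ℝ) z)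
  have hcoe : ((g • z : ℍ) : ℂ) = (g 0 0 * z + g 0 1) / (g 1 0 * z + g 1 1) :=
    UpperHalfPlane.coe_specialLinearGroup_apply g z
  have hdet := det_eq_one g
  have hz := z.im_ne_zero
  rw [← UpperHalfPlane.coe_re, ← UpperHalfPlane.coe_im, hcoe, Complex.div_re, Complex.div_im,
    ← add_div, ← sub_div, div_div_div_cancel_right₀ hdenom.ne', Complex.normSq_apply]
  simp only [Complex.add_re, Complex.add_im, Complex.re_ofReal_mul, Complex.im_ofReal_mul,
    Complex.ofReal_re, Complex.ofReal_im, add_zero, UpperHalfPlane.coe_re, UpperHalfPlane.coe_im]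
  rw [show g 0 0 * z.im * (g 1 0 * z.re + g 1 1) - (g 0 0 * z.re + g 0 1) * (g 1 0 * z.im) = z.im
    by linear_combination z.im * hdet]
  ring

theorem sinh_height_smul_fermi (g : SL(2, ℝ)) (t s : ℝ) : sinh (height (g • fermi t s)) =
    (g 0 0 * g 1 0 * exp t + g 0 1 * g 1 1 * exp (-t)) * cosh s +
      (g 0 0 * g 1 1 + g 0 1 * g 1 0) * sinh s := by
  have hs := (Real.cosh_pos s).ne'
  rw [height, Real.sinh_arsinh, re_div_im_smul, normSq_fermi, re_fermi, im_fermi,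
    Real.tanh_eq_sinh_div_cosh, Real.exp_neg]
  field_simp
  ring

theorem surjective_mul_exp_add_mul_exp_neg {p q : ℝ} (hpq : p * q < 0) :
    Function.Surjective fun t => p * exp t + q * exp (-t) := by
  wlog hp : 0 < p generalizing p q
  · have hp' : p ≠ 0 := left_ne_zero_of_mul hpq.ne
    intro y
    obtain ⟨t, ht⟩ := this (p := -p) (q := -q) (by linarith) (by grind) (-y)
    exact ⟨t, by simp only at ht ⊢; linarith⟩
  intro y
  have hdisc : |y| < √(y ^ 2 - 4 * (p * q)) := by
    rw [← Real.sqrt_sq_eq_abs]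
    exact Real.sqrt_lt_sqrt (sq_nonneg y) (by linarith)
  have hsq := Real.sq_sqrt (show 0 ≤ y ^ 2 - 4 * (p * q) by nlinarith)
  set δ := √(y ^ 2 - 4 * (p * q))
  have hx : 0 < (y + δ) / (2 * p) := div_pos (by linarith [neg_abs_le y]) (by linarith)
  refine ⟨log ((y + δ) / (2 * p)), ?_⟩
  simp only
  rw [Real.exp_neg, Real.exp_log hx]
  have : y + δ ≠ 0 := by linarith [neg_abs_le y]
  field_simp
  linear_combination hsq

/-- The image of the imaginary axis under `g` crosses the axis: its endpoints `a / c` and `b / d`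
are on different sides of `0`. -/
def CrossesAxis (g : SL(2, ℝ)) : Prop := g 0 0 * g 1 0 * (g 0 1 * g 1 1) < 0

theorem CrossesAxis.exists_smul_fermi_eq {g : SL(2, ℝ)} (hg : CrossesAxis g) {σ : ℝ → ℝ}
    (hσ : Continuous σ) {C : ℝ} (hC : ∀ t, |σ t| ≤ C) :
    ∃ t₁ t₂, g • fermi t₁ (σ t₁) = fermi t₂ (σ t₂) := by
  have hsinh (t) : |sinh (σ t)| ≤ sinh C := by
    rw [Real.abs_sinh]
    exact Real.sinh_le_sinh.2 (hC t)
  set u : ℝ → ℍ := fun t => g • fermi t (σ t)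
  have hu : Continuous u := (continuous_fermi continuous_id hσ).const_smul g
  set F : ℝ → ℝ := fun t => sinh (height (u t)) - sinh (σ (foot (u t)))
  have hF : Continuous F := by
    have := continuous_foot
    have := continuous_height
    fun_prop
  set M := |g 0 0 * g 1 1 + g 0 1 * g 1 0| * sinh C + sinh C
  have hM (t) : |F t - (g 0 0 * g 1 0 * exp t + g 0 1 * g 1 1 * exp (-t)) * cosh (σ t)| ≤ M := by
    have h : F t - (g 0 0 * g 1 0 * exp t + g 0 1 * g 1 1 * exp (-t)) * cosh (σ t) =
        (g 0 0 * g 1 1 + g 0 1 * g 1 0) * sinh (σ t) - sinh (σ (foot (u t))) := by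
      simp only [F, u, sinh_height_smul_fermi]
      ring
    rw [h]
    refine (abs_sub _ _).trans (add_le_add ?_ (hsinh _))
    rw [abs_mul]
    exact mul_le_mul_of_nonneg_left (hsinh t) (abs_nonneg _)
  have hM₀ : 0 ≤ M := (abs_nonneg _).trans (hM 0)
  obtain ⟨t_pos, h_pos⟩ := surjective_mul_exp_add_mul_exp_neg hg M
  obtain ⟨t_neg, h_neg⟩ := surjective_mul_exp_add_mul_exp_neg hg (-M)
  simp only at h_pos h_neg
  have hF_nonneg : 0 ≤ F t_pos := by
    have := (abs_le.1 (hM t_pos)).1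
    rw [h_pos] at this
    nlinarith [Real.one_le_cosh (σ t_pos)]
  have hF_nonpos : F t_neg ≤ 0 := by
    have := (abs_le.1 (hM t_neg)).2
    rw [h_neg] at this
    nlinarith [Real.one_le_cosh (σ t_neg)]
  obtain ⟨t, ht⟩ :=
    mem_range_of_exists_le_of_exists_ge hF ⟨t_neg, hF_nonpos⟩ ⟨t_pos, hF_nonneg⟩
  refine ⟨t, foot (u t), ?_⟩
  rw [← Real.sinh_injective (sub_eq_zero.1 ht), fermi_foot_height]

/-- `D` is the translation by `l` along the imaginary axis. -/
def IsTranslation (D : PSL(2, ℝ)) (l : ℝ) : Prop := ∀ t s, D • fermi t s = fermi (t + l) s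

namespace IsTranslation

variable {D : PSL(2, ℝ)} {l : ℝ}

theorem inv (hD : IsTranslation D l) : IsTranslation D⁻¹ (-l) := fun t s => by
  rw [inv_smul_eq_iff, hD, neg_add_cancel_right]

theorem zpow (hD : IsTranslation D l) (k : ℤ) : IsTranslation (D ^ k) (k • l) := by
  induction k with
  | zero => intro t s; simp
  | succ k ih =>
    intro t s
    rw [zpow_add_one, mul_smul, hD, ih, add_smul, one_smul, add_right_comm, add_assoc]
  | pred k ih =>
    intro t s
    rw [zpow_sub_one, mul_smul, hD.inv, ih, sub_smul, one_smul, add_assoc, neg_add_eq_sub]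

theorem smul_neg_half (hD : IsTranslation D l) (s : ℝ) :
    D • fermi (-(l / 2)) s = fermi (l / 2) s := by
  rw [hD]
  ring_nf

theorem cosh_dist_smul (hD : IsTranslation D l) (t s : ℝ) :
    cosh (dist (fermi t s) (D • fermi t s)) = 1 + cosh s ^ 2 * (cosh l - 1) := by
  rw [hD, cosh_dist_fermi, sub_add_cancel_left, Real.cosh_neg]
  linear_combination Real.cosh_sq s

theorem not_crossesAxis {g : SL(2, ℝ)} (hg : IsTranslation g l) : ¬ CrossesAxis g := by
  intro hcross
  obtain ⟨t, ht⟩ := surjective_mul_exp_add_mul_exp_neg hcross 1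
  have h := sinh_height_smul_fermi g t 0
  simp only at ht
  rw [← psl_mk_smul, hg, height_fermi, ht, Real.sinh_zero, Real.cosh_zero, mul_zero, add_zero,
    mul_one] at h
  exact zero_ne_one h

end IsTranslation

theorem eq_fermi_of_foot_of_sinh_height {z : ℍ} {t s : ℝ} (ht : foot z = t)
    (hs : sinh (height z) = sinh s) : z = fermi t s := by
  rw [← ht, ← Real.sinh_injective hs, fermi_foot_height]

theorem norm_coe_smul (g : SL(2, ℝ)) (z : ℍ) :
    ‖((g • z : ℍ) : ℂ)‖ = ‖(g 0 0 * z + g 0 1 : ℂ)‖ / ‖(g 1 0 * z + g 1 1 : ℂ)‖ := by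
  rw [← norm_div]
  exact congrArg _ (UpperHalfPlane.coe_specialLinearGroup_apply g z)

theorem smul_fermi_of_diagonal {g : SL(2, ℝ)} (hb : g 0 1 = 0) (hc : g 1 0 = 0) (t s : ℝ) :
    g • fermi t s = fermi (t + log (g 0 0 ^ 2)) s := by
  have hdet := det_eq_one g
  rw [hb, zero_mul, sub_zero] at hdet
  have ha : g 0 0 ≠ 0 := left_ne_zero_of_mul_eq_one hdet
  refine eq_fermi_of_foot_of_sinh_height ?_ ?_
  · have h : |g 0 0| / |g 1 1| = g 0 0 ^ 2 := by
      rw [eq_one_div_of_mul_eq_one_right hdet, abs_div, abs_one, div_div_eq_mul_div, div_one,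
        abs_mul_abs_self, sq]
    rw [foot, norm_coe_smul, hb, hc, Complex.ofReal_zero, zero_mul, zero_add, add_zero, norm_mul,
      norm_fermi, Complex.norm_real, Complex.norm_real, Real.norm_eq_abs, Real.norm_eq_abs,
      mul_div_right_comm, h, Real.log_mul (pow_ne_zero 2 ha) (Real.exp_ne_zero t), Real.log_exp,
      add_comm]
  · rw [sinh_height_smul_fermi, hb, hc]
    linear_combination sinh s * hdet

theorem smul_fermi_of_antidiagonal {g : SL(2, ℝ)} (ha : g 0 0 = 0) (hd : g 1 1 = 0) (t s : ℝ) :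
    g • fermi t s = fermi (log (g 0 1 ^ 2) - t) (-s) := by
  have hdet := det_eq_one g
  rw [ha, zero_mul, zero_sub, ← mul_neg] at hdet
  have hb : g 0 1 ≠ 0 := left_ne_zero_of_mul_eq_one hdet
  refine eq_fermi_of_foot_of_sinh_height ?_ ?_
  · have h : |g 0 1| / |g 1 0| = g 0 1 ^ 2 := by
      rw [← abs_neg (g 1 0), eq_one_div_of_mul_eq_one_right hdet, abs_div, abs_one,
        div_div_eq_mul_div, div_one, abs_mul_abs_self, sq]
    rw [foot, norm_coe_smul, ha, hd, Complex.ofReal_zero, zero_mul, zero_add, add_zero, norm_mul,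
      norm_fermi, Complex.norm_real, Complex.norm_real, Real.norm_eq_abs, Real.norm_eq_abs,
      ← div_div, h, Real.log_div (pow_ne_zero 2 hb) (Real.exp_ne_zero t), Real.log_exp]
  · rw [sinh_height_smul_fermi, ha, hd, Real.sinh_neg]
    linear_combination -sinh s * hdet

theorem diagonal_or_antidiagonal {g : SL(2, ℝ)} (hg : ¬ CrossesAxis g) {t : ℝ}
    (h : g 0 0 * g 1 0 * exp t + g 0 1 * g 1 1 * exp (-t) = 0) :
    g 0 1 = 0 ∧ g 1 0 = 0 ∨ g 0 0 = 0 ∧ g 1 1 = 0 := by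
  have hdet := det_eq_one g
  have hbd : g 0 1 * g 1 1 = 0 := by
    by_contra hbd
    refine hg (neg_of_mul_neg_left (b := exp t) ?_ (Real.exp_pos t).le)
    calc g 0 0 * g 1 0 * (g 0 1 * g 1 1) * exp t = -((g 0 1 * g 1 1) ^ 2 * exp (-t)) := by
          linear_combination g 0 1 * g 1 1 * h
      _ < 0 := neg_lt_zero.2 (mul_pos (sq_pos_of_ne_zero hbd) (Real.exp_pos (-t)))
  have hac : g 0 0 * g 1 0 = 0 := by
    simpa [hbd] using h
  grind

-- The points `p` and `q` each cut the segment from `w` to `D • w` into two arcs. Joining an arc at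
-- `q` to an arc at `p` by means of `f` gives a loop, and none of these four loops is shorter than
-- the segment.
theorem dist_eq_dist_of_exchange {H α : Type*} [Group H] [PseudoMetricSpace α] [MulAction H α]
    [IsIsometricSMul H α] {f D : H} {w p q : α} (hf : f • p = q)
    (hp : dist w p + dist p (D • w) = dist w (D • w))
    (hq : dist w q + dist q (D • w) = dist w (D • w))
    (hmin : ∀ m n : ℤ, dist w (D • w) ≤ dist w ((D ^ m * f * D ^ n) • w)) :
    dist w p = dist p (D • w) ∧ dist w q = dist q (D • w) := by
  have h₀₀ : dist w (f • w) ≤ dist w q + dist w p := by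
    simpa [← hf, dist_comm p] using dist_triangle w (f • p) (f • w)
  have h₀₁ : dist w ((f * D) • w) ≤ dist w q + dist p (D • w) := by
    simpa [← hf, mul_smul] using dist_triangle w (f • p) (f • D • w)
  have h₁₀ : dist w ((D⁻¹ * f) • w) ≤ dist q (D • w) + dist w p := by
    have h := dist_triangle (D • w) (f • p) (f • w)
    rwa [dist_smul, hf, dist_comm _ q, dist_comm p, ← smul_inv_smul D (f • w), dist_smul,
      ← mul_smul] at h
  have h₁₁ : dist w ((D⁻¹ * f * D) • w) ≤ dist q (D • w) + dist p (D • w) := by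
    have h := dist_triangle (D • w) (f • p) (f • D • w)
    rwa [dist_smul, hf, dist_comm _ q, ← smul_inv_smul D (f • D • w), dist_smul,
      ← mul_smul, ← mul_smul] at h
  have hmin₀₀ := hmin 0 0
  have hmin₀₁ := hmin 0 1
  have hmin₁₀ := hmin (-1) 0
  have hmin₁₁ := hmin (-1) 1
  simp only [zpow_zero, zpow_one, zpow_neg, one_mul, mul_one] at hmin₀₀ hmin₀₁ hmin₁₀ hmin₁₁
  constructor <;> linarith

/-- `D` is a translation of length `l` along the imaginary axis, and among the nontrivial elements
of `G` none displaces the point `fermi (-(l / 2)) s₀` less than `D`. -/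
structure IsMinimalTranslation (G : Subgroup PSL(2, ℝ)) (D : PSL(2, ℝ)) (l s₀ : ℝ) : Prop where
  mem : D ∈ G
  pos : 0 < l
  isTranslation : IsTranslation D l
  dist_le : ∀ γ ∈ G, γ ≠ 1 → dist (fermi (-(l / 2)) s₀) (D • fermi (-(l / 2)) s₀) ≤
    dist (fermi (-(l / 2)) s₀) (γ • fermi (-(l / 2)) s₀)

theorem exists_zpow_smul_brokenGeodesic {D : PSL(2, ℝ)} {l : ℝ} (hD : IsTranslation D l)
    (hl : 0 < l) (s₀ t : ℝ) : ∃ k : ℤ, ∃ τ : ℝ, |τ| ≤ l / 2 ∧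
      D ^ k • fermi t (brokenGeodesic l s₀ t) = fermi τ (brokenGeodesic l s₀ τ) := by
  refine ⟨-round (t / l), t + -round (t / l) • l, ?_, ?_⟩
  · have h := mul_le_mul_of_nonneg_right (abs_sub_round (t / l)) hl.le
    rw [← abs_of_pos hl, ← abs_mul, abs_of_pos hl, sub_mul, div_mul_cancel₀ _ hl.ne'] at h
    rw [neg_smul, zsmul_eq_mul, ← sub_eq_add_neg]
    linarith
  · rw [hD.zpow, AddCircle.coe_add, AddCircle.coe_zsmul, AddCircle.coe_period, smul_zero, add_zero]

namespace IsMinimalTranslation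

variable {G : Subgroup PSL(2, ℝ)} {D : PSL(2, ℝ)} {l s₀ : ℝ}

theorem not_crossesAxis (hG : ∀ γ ∈ G, ∀ z : ℍ, γ • z = z → γ = 1)
    (hD : IsMinimalTranslation G D l s₀) {g : SL(2, ℝ)} (hg : (g : PSL(2, ℝ)) ∈ G) :
    ¬ CrossesAxis g := by
  intro hcross
  have hl := hD.pos
  have : Fact (0 < l) := ⟨hl⟩
  have hσ := continuous_brokenGeodesic s₀ hl.ne'
  obtain ⟨t₁, t₂, ht⟩ := hcross.exists_smul_fermi_eq
    (σ := fun t => brokenGeodesic l s₀ t) (hσ.comp (AddCircle.continuous_mk' l))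
    (fun t => ContinuousMap.norm_coe_le_norm ⟨_, hσ⟩ (t : AddCircle l))
  obtain ⟨k₁, τ₁, hτ₁, h₁⟩ := exists_zpow_smul_brokenGeodesic hD.isTranslation hl s₀ t₁
  obtain ⟨k₂, τ₂, hτ₂, h₂⟩ := exists_zpow_smul_brokenGeodesic hD.isTranslation hl s₀ t₂
  set p₁ := fermi τ₁ (brokenGeodesic l s₀ τ₁)
  set p₂ := fermi τ₂ (brokenGeodesic l s₀ τ₂)
  set f : PSL(2, ℝ) := D ^ k₂ * (g : PSL(2, ℝ)) * D ^ (-k₁)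
  have hf : f • p₁ = p₂ := by
    rw [← h₁, ← h₂, ← ht, mul_smul, mul_smul, ← mul_smul (D ^ (-k₁)), ← zpow_add, neg_add_cancel,
      zpow_zero, one_smul, psl_mk_smul]
  have hfG : f ∈ G := G.mul_mem (G.mul_mem (G.zpow_mem hD.mem _) hg) (G.zpow_mem hD.mem _)
  have hne (m n : ℤ) : D ^ m * f * D ^ n ≠ 1 := by
    intro h
    have hgD : (g : PSL(2, ℝ)) = D ^ (k₁ - n - m - k₂) := by
      calc (g : PSL(2, ℝ)) = D ^ (-k₂ - m) * (D ^ m * f * D ^ n) * D ^ (k₁ - n) := by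
            simp only [f]; group
        _ = _ := by rw [h]; group
    exact (hgD ▸ hD.isTranslation.zpow _ : IsTranslation g _).not_crossesAxis hcross
  have hw := hD.isTranslation.smul_neg_half s₀
  have hmin (m n : ℤ) := hD.dist_le _
    (G.mul_mem (G.mul_mem (G.zpow_mem hD.mem m) hfG) (G.zpow_mem hD.mem n)) (hne m n)
  obtain ⟨h₁, h₂⟩ := dist_eq_dist_of_exchange hf
    (hw ▸ dist_add_dist_brokenGeodesic s₀ hl hτ₁) (hw ▸ dist_add_dist_brokenGeodesic s₀ hl hτ₂) hmin
  rw [hw] at h₁ h₂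
  obtain rfl := foot_eq_of_dist_eq (half_pos hl).ne' h₁
  obtain rfl := foot_eq_of_dist_eq (half_pos hl).ne' h₂
  exact hne 0 0 (by simpa using hG f hfG _ hf)

theorem eq_of_smul_fermi_zero_eq (hG : ∀ γ ∈ G, ∀ z : ℍ, γ • z = z → γ = 1)
    (hD : IsMinimalTranslation G D l s₀) {γ : PSL(2, ℝ)} (hγ : γ ∈ G) {t₁ t₂ : ℝ}
    (ht₁ : t₁ ∈ Set.Ico 0 l) (ht₂ : t₂ ∈ Set.Ico 0 l) (h : γ • fermi t₁ 0 = fermi t₂ 0) :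
    t₁ = t₂ := by
  suffices γ = 1 by simpa [this] using congrArg foot h
  induction γ using QuotientGroup.induction_on with | H g
  have hheight : g 0 0 * g 1 0 * exp t₁ + g 0 1 * g 1 1 * exp (-t₁) = 0 := by
    simpa [← psl_mk_smul, h] using (sinh_height_smul_fermi g t₁ 0).symm
  rcases diagonal_or_antidiagonal (hD.not_crossesAxis hG hγ) hheight with ⟨hb, hc⟩ | ⟨ha, hd⟩
  · by_contra hne
    have htrans : IsTranslation g (log (g 0 0 ^ 2)) := smul_fermi_of_diagonal hb hc
    have hle := Real.cosh_le_cosh.2 (abs_le_abs_of_nonneg dist_nonneg (hD.dist_le _ hγ hne))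
    rw [hD.isTranslation.cosh_dist_smul, htrans.cosh_dist_smul, add_le_add_iff_left,
      mul_le_mul_iff_right₀ (pow_pos (Real.cosh_pos s₀) 2), sub_le_sub_iff_right,
      Real.cosh_le_cosh, abs_of_pos hD.pos] at hle
    have hlt : |log (g 0 0 ^ 2)| < l := by
      rw [htrans] at h
      have := congrArg foot h
      rw [foot_fermi, foot_fermi] at this
      rw [abs_lt]
      constructor <;> linarith [ht₁.1, ht₁.2, ht₂.1, ht₂.2]
    exact hlt.not_ge hle
  · refine hG _ hγ (fermi (log (g 0 1 ^ 2) / 2) 0) ?_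
    rw [psl_mk_smul, smul_fermi_of_antidiagonal ha hd, sub_half, neg_zero]

end IsMinimalTranslation

theorem sinh_half_dist_smul (g : SL(2, ℝ)) (z : ℍ) : sinh (dist z (g • z) / 2) =
    ‖(g 1 0 : ℂ) * z ^ 2 + (g 1 1 - g 0 0) * z - g 0 1‖ / (2 * z.im) := by
  have hdenom : (g 1 0 : ℂ) * z + g 1 1 ≠ 0 :=
    UpperHalfPlane.denom_ne_zero (g : GL (Fin 2) ℝ) z
  have hnorm := norm_ne_zero_iff.2 hdenom
  have hcoe : ((g • z : ℍ) : ℂ) = (g 0 0 * z + g 0 1) / (g 1 0 * z + g 1 1) :=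
    UpperHalfPlane.coe_specialLinearGroup_apply g z
  have him : (g • z).im = z.im / ‖(g 1 0 : ℂ) * z + g 1 1‖ ^ 2 := by
    have h := UpperHalfPlane.im_smul_eq_div_normSq (g : GL (Fin 2) ℝ) z
    rw [Matrix.SpecialLinearGroup.coeToGL_det, Units.val_one, abs_one, one_mul,
      Complex.normSq_eq_norm_sq] at h
    exact h
  have hsqrt : √(z.im * (g • z).im) = z.im / ‖(g 1 0 : ℂ) * z + g 1 1‖ := by
    rw [him, ← mul_div_assoc, ← sq, ← div_pow, Real.sqrt_sq (by positivity)]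
  have hsub : (z : ℂ) - (g • z : ℍ) =
      ((g 1 0 : ℂ) * z ^ 2 + (g 1 1 - g 0 0) * z - g 0 1) / ((g 1 0 : ℂ) * z + g 1 1) := by
    rw [hcoe, eq_div_iff hdenom, sub_mul, div_mul_cancel₀ _ hdenom]
    ring
  rw [UpperHalfPlane.sinh_half_dist, Complex.dist_eq, hsub, hsqrt, norm_div]
  have := z.im_ne_zero
  field_simp

theorem exists_norm_lt_mul_im_of_ne_zero {g : SL(2, ℝ)} (htr : (g 0 0 + g 1 1) ^ 2 ≤ 4)
    (hc : g 1 0 ≠ 0) {δ : ℝ} (hδ : 0 < δ) :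
    ∃ z : ℍ, ‖(g 1 0 : ℂ) * z ^ 2 + (g 1 1 - g 0 0) * z - g 0 1‖ < δ * z.im := by
  have hdet := det_eq_one g
  set a := g 0 0
  set b := g 0 1
  set c := g 1 0
  set d := g 1 1
  set k := 4 - (a + d) ^ 2 + δ ^ 2
  have hk : δ ^ 2 ≤ k := by linarith
  have hk₀ : 0 < k := (pow_pos hδ 2).trans_le hk
  set y := √k / (2 * |c|)
  have hy : 0 < y := div_pos (Real.sqrt_pos.2 hk₀) (by positivity)
  have hy_sq : 4 * c ^ 2 * y ^ 2 = k := by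
    rw [div_pow, Real.sq_sqrt hk₀.le, mul_pow, sq_abs]
    field_simp
    norm_num
  have hval : (c : ℂ) * (((a - d) / (2 * c) : ℝ) + y * Complex.I) ^ 2 +
      (d - a) * (((a - d) / (2 * c) : ℝ) + y * Complex.I) - b = (-(δ ^ 2 / (4 * c)) : ℝ) := by
    have hc' : (c : ℂ) ≠ 0 := Complex.ofReal_ne_zero.2 hc
    have hdet' : (a * d - b * c : ℂ) = 1 := mod_cast hdet
    have hy_sq' : (4 * c ^ 2 * y ^ 2 : ℂ) = 4 - (a + d) ^ 2 + δ ^ 2 := mod_cast hy_sq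
    push_cast
    field_simp
    linear_combination 4 * (4 * c ^ 2 * y ^ 2 * Complex.I_sq - hy_sq' + 4 * hdet')
  have him : (((a - d) / (2 * c) : ℝ) + y * Complex.I).im = y := by
    rw [Complex.add_im, Complex.ofReal_im, Complex.im_ofReal_mul, Complex.I_im, zero_add, mul_one]
  have hyδ : δ / (2 * |c|) ≤ y :=
    div_le_div_of_nonneg_right (Real.le_sqrt_of_sq_le hk) (by positivity)
  refine ⟨⟨((a - d) / (2 * c) : ℝ) + y * Complex.I, him.symm ▸ hy⟩, ?_⟩
  change ‖(c : ℂ) * (((a - d) / (2 * c) : ℝ) + y * Complex.I) ^ 2 +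
    (d - a) * (((a - d) / (2 * c) : ℝ) + y * Complex.I) - b‖ <
      δ * (((a - d) / (2 * c) : ℝ) + y * Complex.I).im
  rw [hval, him, Complex.norm_real, Real.norm_eq_abs, abs_neg, abs_div, abs_mul, abs_sq,
    abs_of_pos four_pos]
  calc δ ^ 2 / (4 * |c|) = δ * (δ / (2 * |c|)) / 2 := by ring
    _ ≤ δ * y / 2 := by gcongr
    _ < δ * y := half_lt_self (mul_pos hδ hy)

theorem exists_dist_smul_lt {g : SL(2, ℝ)} (htr : (g 0 0 + g 1 1) ^ 2 ≤ 4) {ε : ℝ} (hε : 0 < ε) :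
    ∃ z : ℍ, dist z (g • z) < ε := by
  have hδ : 0 < 2 * sinh (ε / 2) := mul_pos two_pos (Real.sinh_pos_iff.2 (half_pos hε))
  suffices ∃ z : ℍ, ‖(g 1 0 : ℂ) * z ^ 2 + (g 1 1 - g 0 0) * z - g 0 1‖ <
      2 * sinh (ε / 2) * z.im by
    obtain ⟨z, hz⟩ := this
    refine ⟨z, (div_lt_div_iff_of_pos_right two_pos).1 (Real.sinh_lt_sinh.1 ?_)⟩
    rw [sinh_half_dist_smul, div_lt_iff₀ (mul_pos two_pos z.im_pos)]
    linarith
  by_cases hc : g 1 0 = 0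
  · have hdet := det_eq_one g
    rw [hc, mul_zero, sub_zero] at hdet
    have had : g 1 1 = g 0 0 := by nlinarith
    refine ⟨⟨⟨0, (|g 0 1| + 1) / (2 * sinh (ε / 2))⟩, by positivity⟩, ?_⟩
    rw [hc, had, UpperHalfPlane.mk_im, mul_div_cancel₀ _ hδ.ne']
    simp
  · exact exists_norm_lt_mul_im_of_ne_zero htr hc hδ

theorem exists_quadratic_fixed_point {g : SL(2, ℝ)} (htr : 4 < (g 0 0 + g 1 1) ^ 2) :
    ∃ r : ℝ, g 1 0 * (r * r) + (g 1 1 - g 0 0) * r - g 0 1 = 0 := by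
  have hdet := det_eq_one g
  by_cases hc : g 1 0 = 0
  · have hne : g 1 1 - g 0 0 ≠ 0 := by
      intro h
      rw [hc] at hdet
      nlinarith
    refine ⟨g 0 1 / (g 1 1 - g 0 0), ?_⟩
    rw [hc]
    field_simp
    ring
  · obtain ⟨r, hr⟩ := exists_quadratic_eq_zero (a := g 1 0) (b := g 1 1 - g 0 0) (c := -g 0 1) hc
      ⟨√((g 0 0 + g 1 1) ^ 2 - 4), by
        rw [Real.mul_self_sqrt (by linarith), discrim]
        linear_combination -4 * hdet⟩
    exact ⟨r, by linarith⟩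

theorem exists_conj_diagonal {g : SL(2, ℝ)} (htr : 4 < (g 0 0 + g 1 1) ^ 2) :
    ∃ h D : SL(2, ℝ), h⁻¹ * g * h = D ∧ D 0 1 = 0 ∧ D 1 0 = 0 ∧ D 0 0 ^ 2 ≠ 1 := by
  obtain ⟨r, hr⟩ := exists_quadratic_fixed_point htr
  have hdet := det_eq_one g
  -- The eigenvalues: `ν` belongs to the eigenvector `(r, 1)`.
  set μ := g 0 0 - g 1 0 * r
  set ν := g 1 0 * r + g 1 1
  have hμν : μ * ν = 1 := by linear_combination hdet - g 1 0 * hr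
  have htr' : 4 < (μ + ν) ^ 2 := by rwa [show μ + ν = g 0 0 + g 1 1 by ring]
  have hne : μ - ν ≠ 0 := fun h => by nlinarith
  set q := g 1 0 / (μ - ν)
  have hq : q * (μ - ν) = g 1 0 := div_mul_cancel₀ _ hne
  set h : SL(2, ℝ) := ⟨!![1 + r * q, r; q, 1], by rw [Matrix.det_fin_two_of]; ring⟩
  set D : SL(2, ℝ) := ⟨!![μ, 0; 0, ν], by rw [Matrix.det_fin_two_of, hμν]; ring⟩
  refine ⟨h, D, ?_, rfl, rfl, fun hD => hne ?_⟩
  · rw [mul_assoc, inv_mul_eq_iff_eq_mul]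
    refine Subtype.ext ?_
    rw [Matrix.SpecialLinearGroup.coe_mul, Matrix.SpecialLinearGroup.coe_mul,
      Matrix.eta_fin_two (g : Matrix (Fin 2) (Fin 2) ℝ), Matrix.mul_fin_two, Matrix.mul_fin_two]
    simp only [EmbeddingLike.apply_eq_iff_eq, Matrix.vecCons_inj, and_true]
    refine ⟨⟨?_, ?_⟩, ?_, ?_⟩
    · linear_combination -r * hq - q * hr
    · linear_combination -hr
    · linear_combination -hq
    · ring
  · have : μ ^ 2 = 1 := hD
    have : μ * (μ - ν) = 0 := by linear_combination this - hμν
    grind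

theorem conj_mul_eq {H : Type*} [Group H] (g h k : H) :
    (h * k)⁻¹ * g * (h * k) = k⁻¹ * (h⁻¹ * g * h) * k := by group

theorem exists_conj_isTranslation {g : SL(2, ℝ)} (htr : 4 < (g 0 0 + g 1 1) ^ 2) :
    ∃ h : PSL(2, ℝ), ∃ l, 0 < l ∧ IsTranslation (h⁻¹ * g * h) l := by
  obtain ⟨h, D, hD, hb, hc, ha⟩ := exists_conj_diagonal htr
  have htrans : IsTranslation ((h : PSL(2, ℝ))⁻¹ * g * h) (log (D 0 0 ^ 2)) := by
    rw [← QuotientGroup.mk_inv, ← QuotientGroup.mk_mul, ← QuotientGroup.mk_mul, hD]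
    exact smul_fermi_of_diagonal hb hc
  have hl : log (D 0 0 ^ 2) ≠ 0 := by
    have : D 0 0 ≠ 0 := fun h0 => by simpa [h0, hb] using det_eq_one D
    exact Real.log_ne_zero_of_pos_of_ne_one (by positivity) ha
  rcases hl.lt_or_gt with hl | hl
  · set J : SL(2, ℝ) := ⟨!![0, -1; 1, 0], by simp⟩
    have hJ (t s : ℝ) : (J : PSL(2, ℝ)) • fermi t s = fermi (-t) (-s) := by
      rw [psl_mk_smul, smul_fermi_of_antidiagonal rfl rfl]
      simp [J]
    refine ⟨h * J, _, neg_pos.2 hl, fun t s => ?_⟩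
    rw [conj_mul_eq, mul_smul, mul_smul, inv_smul_eq_iff, hJ, hJ, htrans]
    ring_nf
  · exact ⟨h, _, hl, htrans⟩

theorem exists_isTranslation (u : ℝ) : ∃ S : PSL(2, ℝ), IsTranslation S u := by
  set S : SL(2, ℝ) := ⟨!![exp (u / 2), 0; 0, exp (-(u / 2))], by
    rw [Matrix.det_fin_two_of, ← Real.exp_add, add_neg_cancel, Real.exp_zero, mul_zero, sub_zero]⟩
  refine ⟨S, fun t s => ?_⟩
  rw [psl_mk_smul, smul_fermi_of_diagonal rfl rfl]
  change fermi (t + log (exp (u / 2) ^ 2)) s = _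
  rw [Real.log_pow, Real.log_exp, Nat.cast_ofNat, mul_div_cancel₀ _ two_ne_zero]

theorem exists_conj_isTranslation_smul_eq {g : SL(2, ℝ)} (htr : 4 < (g 0 0 + g 1 1) ^ 2) (z : ℍ) :
    ∃ h : PSL(2, ℝ), ∃ l s₀, 0 < l ∧ IsTranslation (h⁻¹ * g * h) l ∧
      h • fermi (-(l / 2)) s₀ = z := by
  obtain ⟨h, l, hl, htrans⟩ := exists_conj_isTranslation htr
  obtain ⟨S, hS⟩ := exists_isTranslation (foot (h⁻¹ • z) + l / 2)
  refine ⟨h * S, l, height (h⁻¹ • z), hl, fun t s => ?_, ?_⟩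
  · rw [conj_mul_eq, mul_smul, mul_smul, inv_smul_eq_iff, hS, hS, htrans, add_right_comm]
  · rw [mul_smul, hS, neg_add_cancel_comm_assoc, fermi_foot_height, smul_inv_smul]

instance : SMulInvariantMeasure SL(2, ℝ) ℍ volume where
  measure_preimage_smul g _ hs := measure_preimage_smul_of_nullMeasurableSet
    (G := GL (Fin 2) ℝ) hs.nullMeasurableSet (Matrix.SpecialLinearGroup.toGL g)

instance : SMulInvariantMeasure PSL(2, ℝ) ℍ volume where
  measure_preimage_smul γ s hs := by
    induction γ using QuotientGroup.induction_on with
    | H g => exact SMulInvariantMeasure.measure_preimage_smul g hs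

theorem norm_discPoint (z : ℍ) (v : ℂ) : ‖discPoint z v‖ = tanh (‖v‖ / (2 * z.im)) := by
  have htanh : 0 ≤ tanh (‖v‖ / (2 * z.im)) := by
    rw [Real.tanh_eq_sinh_div_cosh]
    exact div_nonneg (Real.sinh_nonneg_iff.2 (by positivity)) (Real.cosh_pos _).le
  rw [discPoint, norm_mul, norm_mul, norm_neg, Complex.norm_I, one_mul, Complex.norm_real,
    norm_div, Complex.norm_real, norm_norm, Real.norm_of_nonneg htanh]
  rcases eq_or_ne v 0 with rfl | hv
  · rw [norm_zero, zero_div, Real.tanh_zero, zero_mul]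
  · rw [div_self (norm_ne_zero_iff.2 hv), mul_one]

theorem discPoint_injective (z : ℍ) : Function.Injective (discPoint z) := by
  intro v w h
  have hz := z.im_pos
  have hnorm : ‖v‖ = ‖w‖ := by
    have h' := congrArg norm h
    rw [norm_discPoint, norm_discPoint] at h'
    exact (div_left_inj' (by positivity)).1 (Real.tanh_injective h')
  rcases eq_or_ne v 0 with rfl | hv
  · exact (norm_eq_zero.1 (hnorm ▸ norm_zero)).symm
  · have hv' : 0 < ‖v‖ := norm_pos_iff.2 hv
    have htanh : tanh (‖v‖ / (2 * z.im)) ≠ 0 := by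
      rw [← Real.tanh_zero]
      exact Real.tanh_injective.ne (by positivity)
    rw [discPoint, discPoint, ← hnorm] at h
    exact (div_left_inj' (Complex.ofReal_ne_zero.2 hv'.ne')).1 (mul_left_cancel₀
      (mul_ne_zero (neg_ne_zero.2 Complex.I_ne_zero) (Complex.ofReal_ne_zero.2 htanh)) h)

theorem one_sub_discPoint_ne_zero (z : ℍ) (v : ℂ) : 1 - discPoint z v ≠ 0 :=
  (isUnit_one_sub_of_norm_lt_one (norm_discPoint_lt_one z v)).ne_zero

theorem coe_hexp (z : ℍ) (v : ℂ) : (hexp z v : ℂ) =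
    z.re + z.im * (Complex.I * (1 + discPoint z v) / (1 - discPoint z v)) := rfl

theorem dist_hexp (z : ℍ) (v : ℂ) : dist z (hexp z v) = ‖v‖ / z.im := by
  have hζ := one_sub_discPoint_ne_zero z v
  have hw := coe_hexp z v
  set ζ := discPoint z v with hζ_def
  have hsub : (hexp z v : ℂ) - z = 2 * z.im * Complex.I * ζ / (1 - ζ) := by
    rw [hw, ← UpperHalfPlane.re_add_im z]
    field_simp
    ring
  have hsub_conj : (hexp z v : ℂ) - (starRingEnd ℂ) z = 2 * z.im * Complex.I / (1 - ζ) := by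
    rw [hw, ← UpperHalfPlane.re_add_im z]
    simp only [map_add, map_mul, Complex.conj_ofReal, Complex.conj_I]
    field_simp
    ring
  have hne : ‖2 * z.im * Complex.I / (1 - ζ)‖ ≠ 0 := by
    simp [hζ, z.im_ne_zero]
  have htanh : tanh (dist z (hexp z v) / 2) = tanh (‖v‖ / (2 * z.im)) := by
    rw [← norm_discPoint, ← hζ_def, dist_comm, UpperHalfPlane.tanh_half_dist, Complex.dist_eq,
      Complex.dist_eq, hsub, hsub_conj, mul_div_right_comm, norm_mul, mul_div_cancel_left₀ _ hne]
  have := Real.tanh_injective htanh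
  rw [mul_comm, ← div_div] at this
  exact (div_left_inj' two_ne_zero).1 this

theorem hexp_injective (z : ℍ) : Function.Injective (hexp z) := by
  intro v w h
  refine discPoint_injective z ?_
  have h' := congrArg UpperHalfPlane.coe h
  rw [coe_hexp, coe_hexp, add_right_inj, mul_right_inj' (Complex.ofReal_ne_zero.2 z.im_ne_zero),
    div_eq_div_iff (one_sub_discPoint_ne_zero z v) (one_sub_discPoint_ne_zero z w), mul_assoc,
    mul_assoc, mul_right_inj' Complex.I_ne_zero] at h'
  linear_combination h' / 2

theorem volume_setOf_re_im_mem {s : Set (ℝ × ℝ)} (hs : MeasurableSet s) :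
    volume {z : ℍ | (z.re, z.im) ∈ s} =
      ∫⁻ y in Set.Ioi 0, ENNReal.ofReal ((y ^ 2)⁻¹) * volume {x | (x, y) ∈ s} := by
  have himage : UpperHalfPlane.coe '' {z : ℍ | (z.re, z.im) ∈ s} =
      Complex.measurableEquivRealProd ⁻¹' (s ∩ Set.univ ×ˢ Set.Ioi 0) := by
    ext z
    exact ⟨fun ⟨w, hw, h⟩ => h ▸ ⟨hw, Set.mem_univ _, w.im_pos⟩,
      fun h => ⟨⟨z, h.2.2⟩, h.1, rfl⟩⟩
  have hdensity (z : ℂ) : (((1 / ‖z.im‖₊) ^ 2 : ℝ≥0) : ℝ≥0∞) =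
      ENNReal.ofReal (((Complex.measurableEquivRealProd z).2 ^ 2)⁻¹) := by
    rw [ENNReal.ofReal, ENNReal.coe_inj, ← NNReal.coe_inj, Real.coe_toNNReal _ (by positivity)]
    simp
  have hmeas : Measurable (s.indicator fun u => ENNReal.ofReal ((u.2 ^ 2)⁻¹)) :=
    Measurable.indicator (by fun_prop) hs
  rw [UpperHalfPlane.volume_eq_lintegral, himage]
  simp_rw [hdensity]
  rw [Complex.volume_preserving_equiv_real_prod.setLIntegral_comp_preimage_emb
      Complex.measurableEquivRealProd.measurableEmbedding (fun u => ENNReal.ofReal ((u.2 ^ 2)⁻¹)),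
    ← Measure.restrict_restrict hs, Measure.volume_eq_prod, ← Measure.prod_restrict,
    Measure.restrict_univ, ← lintegral_indicator hs, lintegral_prod_symm' _ hmeas]
  exact lintegral_congr fun y =>
    lintegral_indicator_const (measurable_prodMk_right hs) (ENNReal.ofReal ((y ^ 2)⁻¹))

theorem finite_setOf_quadratic_eq_zero {K : Type*} [Field K] {a b c : K} (h : a ≠ 0 ∨ b ≠ 0) :
    {x : K | a * x ^ 2 + b * x + c = 0}.Finite := by
  open Polynomial in
  have hp : C a * X ^ 2 + C b * X + C c ≠ 0 := by
    intro h0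
    have hb : b = 0 := by simpa [coeff_C] using congrArg (coeff · 1) h0
    have ha : a = 0 := by simpa [coeff_C] using congrArg (coeff · 2) h0
    exact h.elim (· ha) (· hb)
  exact (Polynomial.finite_setOfPred_isRoot hp).subset fun x hx => by simpa using hx

theorem volume_setOf_dist_eq_dist {p q : ℍ} (hpq : p ≠ q) :
    volume {z : ℍ | dist z p = dist z q} = 0 := by
  have hset : {z : ℍ | dist z p = dist z q} = {z : ℍ | (z.re, z.im) ∈ {u : ℝ × ℝ |
      q.im * ((u.1 - p.re) ^ 2 + u.2 ^ 2 + p.im ^ 2) =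
        p.im * ((u.1 - q.re) ^ 2 + u.2 ^ 2 + q.im ^ 2)}} := by
    ext z
    have hz := z.im_pos
    have hp := p.im_pos
    have hq := q.im_pos
    simp only [Set.mem_ofPred_eq]
    rw [← Real.cosh_strictMonoOn.injOn.eq_iff dist_nonneg dist_nonneg, UpperHalfPlane.cosh_dist',
      UpperHalfPlane.cosh_dist', div_eq_div_iff (by positivity) (by positivity), mul_comm,
      mul_comm (_ + _), mul_assoc (2 * z.im), mul_assoc (2 * z.im),
      mul_right_inj' (mul_pos two_pos hz).ne']
  rw [hset, volume_setOf_re_im_mem (measurableSet_eq_fun (by fun_prop) (by fun_prop))]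
  refine (lintegral_congr fun y => ?_).trans lintegral_zero
  refine mul_eq_zero_of_right _ (Set.Finite.measure_zero ?_ _)
  refine (finite_setOf_quadratic_eq_zero (a := q.im - p.im) (b := 2 * (p.im * q.re - q.im * p.re))
    (c := q.im * (p.re ^ 2 + y ^ 2 + p.im ^ 2) - p.im * (q.re ^ 2 + y ^ 2 + q.im ^ 2)) ?_).subset
    fun x hx => ?_
  · by_contra! hcoeff
    have him : q.im = p.im := sub_eq_zero.1 hcoeff.1
    have hre : p.im * (q.re - p.re) = 0 := by linarith [him ▸ hcoeff.2]
    exact hpq (UpperHalfPlane.ext_re_im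
      (sub_eq_zero.1 ((mul_eq_zero.1 hre).resolve_left p.im_ne_zero)).symm him.symm)
  · simp only [Set.mem_ofPred_eq] at hx ⊢
    linear_combination hx

/-- A fundamental domain of the translation by `l` along the imaginary axis acting on the
neighbourhood `|re| ≤ K im` of the axis. -/
def strip (K l : ℝ) : Set ℍ := {z | z.im ∈ Set.Ico 1 (exp l) ∧ |z.re| ≤ K * z.im}

theorem measurableSet_strip (K l : ℝ) : MeasurableSet (strip K l) := by
  have hre := UpperHalfPlane.continuous_re.measurable
  have him := UpperHalfPlane.continuous_im.measurable
  exact (him measurableSet_Ico).inter (measurableSet_le hre.abs (him.const_mul K))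

theorem lintegral_Ico_ofReal_mul_inv {a b c : ℝ} (ha : 0 < a) (hab : a ≤ b) (hc : 0 ≤ c) :
    ∫⁻ y in Set.Ico a b, ENNReal.ofReal (c * y⁻¹) = ENNReal.ofReal (c * log (b / a)) := by
  have hint : IntegrableOn (fun y => c * y⁻¹) (Set.Ico a b) :=
    (ContinuousOn.integrableOn_Icc (continuousOn_const.mul (continuousOn_inv₀.mono fun y hy =>
      (ha.trans_le hy.1).ne'))).mono_set Set.Ico_subset_Icc_self
  rw [← ofReal_integral_eq_lintegral_ofReal hint, integral_const_mul,
    integral_Ico_eq_integral_Ioc, ← intervalIntegral.integral_of_le hab,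
    integral_inv_of_pos ha (ha.trans_le hab)]
  filter_upwards [ae_restrict_mem measurableSet_Ico] with y hy
  exact mul_nonneg hc (inv_nonneg.2 (ha.le.trans hy.1))

theorem volume_strip {K l : ℝ} (hK : 0 ≤ K) (hl : 0 ≤ l) :
    volume (strip K l) = ENNReal.ofReal (2 * K * l) := by
  set S : Set (ℝ × ℝ) := {u | u.2 ∈ Set.Ico 1 (exp l) ∧ |u.1| ≤ K * u.2}
  have hS : MeasurableSet S := (measurable_snd measurableSet_Ico).inter
    (measurableSet_le measurable_fst.abs (measurable_snd.const_mul K))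
  have hpos : Set.Ico 1 (exp l) ⊆ Set.Ioi 0 := fun y hy => one_pos.trans_le hy.1
  have hslice (y : ℝ) : ENNReal.ofReal ((y ^ 2)⁻¹) * volume {x | (x, y) ∈ S} =
      (Set.Ico 1 (exp l)).indicator (fun y => ENNReal.ofReal (2 * K * y⁻¹)) y := by
    by_cases hy : y ∈ Set.Ico 1 (exp l)
    · have hIcc : {x | (x, y) ∈ S} = Set.Icc (-(K * y)) (K * y) :=
        Set.ext fun x => (and_iff_right hy).trans abs_le
      have hy₀ : y ≠ 0 := (hpos hy).ne'
      rw [Set.indicator_of_mem hy, hIcc, Real.volume_Icc, ← ENNReal.ofReal_mul (by positivity)]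
      congr 1
      field_simp
      ring
    · have hempty : {x | (x, y) ∈ S} = ∅ := Set.eq_empty_of_forall_notMem fun x hx => hy hx.1
      rw [Set.indicator_of_notMem hy, hempty, measure_empty, mul_zero]
  rw [show strip K l = {z | (z.re, z.im) ∈ S} from rfl, volume_setOf_re_im_mem hS]
  simp_rw [hslice]
  rw [lintegral_indicator measurableSet_Ico, Measure.restrict_restrict measurableSet_Ico,
    Set.inter_eq_left.2 hpos, lintegral_Ico_ofReal_mul_inv one_pos (Real.one_le_exp hl)
    (by positivity), div_one, Real.log_exp]

open scoped Pointwise in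
theorem measure_setOf_exists_smul_mem_inter_le {G α : Type*} [Group G] [Countable G]
    [MulAction G α] [MeasurableSpace α] [MeasurableConstSMul G α] {μ : Measure α}
    [SMulInvariantMeasure G α μ] {s : Set α} (hs : IsFundamentalDomain G s μ) (t : Set α) :
    μ (s ∩ {x | ∃ g : G, g • x ∈ t}) ≤ μ t := by
  have hsub : s ∩ {x | ∃ g : G, g • x ∈ t} ⊆ ⋃ g : G, g • t ∩ s := by
    rintro x ⟨hx, g, hg⟩
    exact Set.mem_iUnion.2 ⟨g⁻¹, Set.mem_inv_smul_set_iff.2 hg, hx⟩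
  rw [hs.measure_eq_tsum t]
  exact (measure_mono hsub).trans (measure_iUnion_le _)

namespace IsTranslation

variable {D : PSL(2, ℝ)} {l : ℝ}

theorem sinh_half_dist_smul (hD : IsTranslation D l) (hl : 0 ≤ l) (t s : ℝ) :
    sinh (dist (fermi t s) (D • fermi t s) / 2) = cosh s * sinh (l / 2) := by
  have hcosh (u : ℝ) : cosh u = 1 + 2 * sinh (u / 2) ^ 2 := by
    rw [← mul_div_cancel₀ u two_ne_zero, Real.cosh_two_mul, Real.cosh_sq,
      mul_div_cancel_left₀ _ two_ne_zero]
    ring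
  have hsinh : 0 ≤ sinh (l / 2) := Real.sinh_nonneg_iff.2 (by positivity)
  have h := hD.cosh_dist_smul t s
  rw [hcosh, hcosh l] at h
  rw [← sq_eq_sq₀ (Real.sinh_nonneg_iff.2 (by positivity)) (by positivity)]
  linear_combination h / 2

theorem exists_zpow_smul_mem_strip (hD : IsTranslation D l) (hl : 0 < l) {K t s : ℝ}
    (hs : |sinh s| ≤ K) : ∃ k : ℤ, D ^ k • fermi t s ∈ strip K l := by
  have hcosh := Real.cosh_pos s
  obtain ⟨k, hk, -⟩ := existsUnique_add_zsmul_mem_Ico hl (t - log (cosh s)) 0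
  have him : (D ^ k • fermi t s).im = exp (t - log (cosh s) + k • l) := by
    rw [hD.zpow, im_fermi, sub_add_eq_add_sub, Real.exp_sub, Real.exp_log hcosh]
  have hre : (D ^ k • fermi t s).re = sinh s * (D ^ k • fermi t s).im := by
    rw [hD.zpow, re_fermi, im_fermi, Real.tanh_eq_sinh_div_cosh]
    ring
  refine ⟨k, ⟨?_, ?_⟩, ?_⟩
  · rw [him]
    exact Real.one_le_exp hk.1
  · rw [him]
    exact Real.exp_lt_exp.2 (hk.2.trans_eq (zero_add l))
  · rw [hre, abs_mul, abs_of_pos (UpperHalfPlane.im_pos _)]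
    exact mul_le_mul_of_nonneg_right hs (UpperHalfPlane.im_pos _).le

end IsTranslation

theorem exists_mem_forall_lt_two_mul {A : Set ℝ} (hA : A.Nonempty) {ε : ℝ} (hε : 0 < ε)
    (hle : ∀ l ∈ A, ε ≤ l) : ∃ l ∈ A, ∀ l' ∈ A, l < 2 * l' := by
  have hinf : 0 < sInf A := hε.trans_le (le_csInf hA hle)
  obtain ⟨l, hl, hlt⟩ := exists_lt_of_csInf_lt hA (lt_two_mul_self hinf)
  exact ⟨l, hl, fun l' hl' =>
    hlt.trans_le (mul_le_mul_of_nonneg_left (csInf_le ⟨ε, hle⟩ hl') two_pos.le)⟩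

theorem measure_biUnion_le_encard_mul {ι α : Type*} [MeasurableSpace α] (μ : Measure α)
    {I : Set ι} {f : ι → Set α} {c : ℝ≥0∞} (hc : c ≠ 0) (h : ∀ i ∈ I, μ (f i) ≤ c) :
    μ (⋃ i ∈ I, f i) ≤ (I.encard : ℝ≥0∞) * c := by
  rcases I.finite_or_infinite with hI | hI
  · calc μ (⋃ i ∈ I, f i) ≤ ∑' i : I, μ (f i) := measure_biUnion_le μ hI.countable f
      _ ≤ ∑' _ : I, c := ENNReal.tsum_le_tsum fun i => h i i.2
      _ = (I.encard : ℝ≥0∞) * c := ENNReal.tsum_set_const I c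
  · rw [hI.encard_eq, ENat.toENNReal_top, ENNReal.top_mul hc]
    exact le_top

end HyperbolicSurface

namespace ClosedHyperbolicSurface

open HyperbolicSurface
open Real (sinh cosh)

variable (X : ClosedHyperbolicSurface)

theorem proj_eq_iff {z w : ℍ} : X.proj z = X.proj w ↔ ∃ γ ∈ X.Γ, γ • w = z := by
  rw [proj, proj, Quotient.eq]
  exact ⟨fun ⟨γ, h⟩ => ⟨γ, γ.2, h⟩, fun ⟨γ, hγ, h⟩ => ⟨⟨γ, hγ⟩, h⟩⟩

theorem proj_smul {γ : PSL(2, ℝ)} (hγ : γ ∈ X.Γ) (z : ℍ) : X.proj (γ • z) = X.proj z :=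
  X.proj_eq_iff.2 ⟨γ, hγ, rfl⟩

theorem finite_dist_smul_le (z w : ℍ) (r : ℝ) :
    {γ : PSL(2, ℝ) | γ ∈ X.Γ ∧ dist z (γ • w) ≤ r}.Finite := by
  have := X.properlyDiscontinuous
  have h := ProperlyDiscontinuousSMul.finite_disjoint_inter_image (Γ := X.Γ)
    (isCompact_singleton (x := w)) (isCompact_closedBall z r)
  refine (h.image Subtype.val).subset ?_
  rintro γ ⟨hγ, hd⟩
  exact ⟨⟨γ, hγ⟩, ⟨γ • w, ⟨w, rfl, rfl⟩, Metric.mem_closedBall'.2 hd⟩, rfl⟩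

theorem countable_Γ : (X.Γ : Set PSL(2, ℝ)).Countable := by
  refine (Set.countable_iUnion fun n : ℕ =>
    (X.finite_dist_smul_le UpperHalfPlane.I UpperHalfPlane.I n).countable).mono fun γ hγ => ?_
  obtain ⟨n, hn⟩ := exists_nat_ge (dist UpperHalfPlane.I (γ • UpperHalfPlane.I))
  exact Set.mem_iUnion.2 ⟨n, hγ, hn⟩

theorem exists_min_dist_smul {S : Set PSL(2, ℝ)} (hS : S ⊆ X.Γ) (hne : S.Nonempty) (z w : ℍ) :
    ∃ γ₀ ∈ S, ∀ γ ∈ S, dist z (γ₀ • w) ≤ dist z (γ • w) := by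
  obtain ⟨β, hβ⟩ := hne
  have hfin : {γ ∈ S | dist z (γ • w) ≤ dist z (β • w)}.Finite :=
    (X.finite_dist_smul_le z w (dist z (β • w))).subset fun γ hγ => ⟨hS hγ.1, hγ.2⟩
  obtain ⟨γ₀, h₀, hmin⟩ :=
    Set.exists_min_image _ (fun γ => dist z (γ • w)) hfin ⟨β, hβ, le_rfl⟩
  exact ⟨γ₀, h₀.1, fun γ hγ =>
    (le_total (dist z (γ • w)) (dist z (β • w))).elim (fun h => hmin γ ⟨hγ, h⟩) h₀.2.trans⟩

theorem exists_pos_le_dist_smul_at (z : ℍ) :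
    ∃ ε > 0, ∀ γ ∈ X.Γ, γ ≠ 1 → ε ≤ dist z (γ • z) := by
  rcases Set.eq_empty_or_nonempty {γ ∈ (X.Γ : Set PSL(2, ℝ)) | γ ≠ 1} with h | h
  · exact ⟨1, one_pos, fun γ hγ hne => ((h ▸ ⟨hγ, hne⟩ : γ ∈ (∅ : Set PSL(2, ℝ)))).elim⟩
  · obtain ⟨γ₀, ⟨hγ₀, hne⟩, hmin⟩ := X.exists_min_dist_smul (fun γ hγ => hγ.1) h z z
    exact ⟨dist z (γ₀ • z), dist_pos.2 fun h => hne (X.free γ₀ hγ₀ z h.symm),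
      fun γ hγ hγ1 => hmin γ ⟨hγ, hγ1⟩⟩

theorem isOpenMap_proj : IsOpenMap X.proj :=
  have : ContinuousConstSMul X.Γ ℍ :=
    ⟨fun γ => (isometry_smul ℍ (γ : PSL(2, ℝ))).continuous⟩
  isOpenMap_quotient_mk'_mul

theorem exists_pos_le_dist_smul :
    ∃ ε > 0, ∀ γ ∈ X.Γ, γ ≠ 1 → ∀ z : ℍ, ε ≤ dist z (γ • z) := by
  have := X.compact
  suffices ∃ ε > 0, ∀ z, X.proj z ∈ Set.univ → ∀ γ ∈ X.Γ, γ ≠ 1 → ε ≤ dist z (γ • z) by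
    obtain ⟨ε, hε, h⟩ := this
    exact ⟨ε, hε, fun γ hγ hne z => h z (Set.mem_univ _) γ hγ hne⟩
  refine isCompact_univ.induction_on (p := fun s : Set X.Point => ∃ ε > 0, ∀ z, X.proj z ∈ s →
    ∀ γ ∈ X.Γ, γ ≠ 1 → ε ≤ dist z (γ • z)) ⟨1, one_pos, by simp⟩ ?_ ?_ ?_
  · rintro s t hst ⟨ε, hε, h⟩
    exact ⟨ε, hε, fun z hz => h z (hst hz)⟩
  · rintro s t ⟨ε, hε, h⟩ ⟨δ, hδ, h'⟩
    refine ⟨min ε δ, lt_min hε hδ, fun z hz γ hγ hne => min_le_iff.2 ?_⟩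
    exact hz.imp (h z · γ hγ hne) (h' z · γ hγ hne)
  · intro p _
    obtain ⟨z, rfl⟩ := Quotient.exists_rep p
    obtain ⟨ε, hε, h⟩ := X.exists_pos_le_dist_smul_at z
    have hε' : 0 < ε / 3 := by linarith
    refine ⟨X.proj '' Metric.ball z (ε / 3), mem_nhdsWithin_of_mem_nhds
      (X.isOpenMap_proj.image_mem_nhds (Metric.ball_mem_nhds z hε')), ε / 3, hε', ?_⟩
    rintro w ⟨w', hw', hproj⟩ γ hγ hne
    obtain ⟨β, hβ, rfl⟩ := X.proj_eq_iff.1 hproj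
    have hconj := h (β * γ * β⁻¹) (X.Γ.mul_mem (X.Γ.mul_mem hβ hγ) (X.Γ.inv_mem hβ))
      (mt conj_eq_one_iff.1 hne)
    have hdist : dist (β • w) ((β * γ * β⁻¹) • β • w) = dist w (γ • w) := by
      rw [mul_smul, mul_smul, inv_smul_smul, dist_smul]
    have htri := dist_triangle4 z (β • w) ((β * γ * β⁻¹) • β • w) ((β * γ * β⁻¹) • z)
    rw [hdist, dist_smul, dist_comm (β • w) z] at htri
    rw [Metric.mem_ball, dist_comm] at hw'
    linarith

theorem four_lt_sq_trace {g : SL(2, ℝ)} (hg : (g : PSL(2, ℝ)) ∈ X.Γ) (hne : (g : PSL(2, ℝ)) ≠ 1) :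
    4 < (g 0 0 + g 1 1) ^ 2 := by
  obtain ⟨ε, hε, h⟩ := X.exists_pos_le_dist_smul
  by_contra! htr
  obtain ⟨z, hz⟩ := exists_dist_smul_lt htr hε
  exact (h g hg hne z).not_gt hz

theorem exists_dist_smul_lt_of_mem_thinPart {R : ℝ} (hR : 0 < R) {z : ℍ}
    (hz : X.proj z ∈ X.thinPart R) : ∃ γ ∈ X.Γ, γ ≠ 1 ∧ dist z (γ • z) < 2 * R := by
  by_contra! hfar
  refine (show X.injRad (X.proj z) < ENNReal.ofReal R from hz).not_ge ?_
  refine le_iSup₂_of_le R.toNNReal ⟨z, rfl, fun v hv w hw hvw => ?_⟩ le_rfl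
  rw [tangentBall, Set.mem_ofPred_eq, Real.coe_toNNReal R hR.le] at hv hw
  obtain ⟨γ, hγ, h⟩ := X.proj_eq_iff.1 hvw
  obtain rfl : γ = 1 := by
    by_contra hne
    refine (hfar γ hγ hne).not_gt ?_
    calc dist z (γ • z) ≤ dist z (hexp z v) + dist (γ • hexp z w) (γ • z) :=
          h ▸ dist_triangle _ _ _
      _ = ‖v‖ / z.im + ‖w‖ / z.im := by rw [dist_smul, dist_comm _ z, dist_hexp, dist_hexp]
      _ < 2 * R := by linarith
  rw [one_smul] at h
  exact (hexp_injective z h).symm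

instance : Countable X.Γ := X.countable_Γ.to_subtype

theorem measurableSet_dirichletDomain : MeasurableSet X.dirichletDomain := by
  have hinter : X.dirichletDomain = ⋂ γ ∈ X.Γ,
      {z : ℍ | dist z UpperHalfPlane.I ≤ dist z (γ • UpperHalfPlane.I)} := by
    ext z
    simp only [dirichletDomain, Set.mem_ofPred_eq, Set.mem_iInter]
  rw [hinter]
  exact (isClosed_biInter fun γ _ => isClosed_le (by fun_prop) (by fun_prop)).measurableSet

theorem mem_smul_dirichletDomain_iff {γ : PSL(2, ℝ)} (hγ : γ ∈ X.Γ) {z : ℍ} :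
    γ⁻¹ • z ∈ X.dirichletDomain ↔
      ∀ β ∈ X.Γ, dist z (γ • UpperHalfPlane.I) ≤ dist z (β • UpperHalfPlane.I) := by
  have h (w : ℍ) : dist (γ⁻¹ • z) w = dist z (γ • w) := by
    rw [← dist_smul γ, smul_inv_smul]
  simp only [dirichletDomain, Set.mem_ofPred_eq, h, smul_smul]
  exact ⟨fun H β hβ => by simpa using H (γ⁻¹ * β) (X.Γ.mul_mem (X.Γ.inv_mem hγ) hβ),
    fun H β hβ => H _ (X.Γ.mul_mem hγ hβ)⟩

theorem isFundamentalDomain_dirichletDomain : IsFundamentalDomain X.Γ X.dirichletDomain where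
  nullMeasurableSet := X.measurableSet_dirichletDomain.nullMeasurableSet
  ae_covers := Eventually.of_forall fun z => by
    obtain ⟨γ, hγ, hmin⟩ := X.exists_min_dist_smul subset_rfl ⟨1, X.Γ.one_mem⟩ z UpperHalfPlane.I
    exact ⟨⟨γ, hγ⟩⁻¹, (X.mem_smul_dirichletDomain_iff hγ).2 hmin⟩
  aedisjoint γ β hne := by
    have hI : (γ : PSL(2, ℝ)) • UpperHalfPlane.I ≠ (β : PSL(2, ℝ)) • UpperHalfPlane.I := by
      intro h
      refine hne (Subtype.ext (inv_mul_eq_one.1 (X.free _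
        (X.Γ.mul_mem (X.Γ.inv_mem β.2) γ.2) UpperHalfPlane.I ?_)).symm)
      rw [mul_smul, h, inv_smul_smul]
    refine measure_mono_null (fun z hz => ?_) (volume_setOf_dist_eq_dist hI)
    have hγ := (X.mem_smul_dirichletDomain_iff γ.2).1 (Set.mem_smul_set_iff_inv_smul_mem.1 hz.1)
    have hβ := (X.mem_smul_dirichletDomain_iff β.2).1 (Set.mem_smul_set_iff_inv_smul_mem.1 hz.2)
    exact le_antisymm (hγ β β.2) (hβ γ γ.2)

instance : SMulInvariantMeasure X.Γ ℍ volume where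
  measure_preimage_smul γ _ hs :=
    SMulInvariantMeasure.measure_preimage_smul (γ : PSL(2, ℝ)) hs

instance : MeasurableConstSMul X.Γ ℍ where
  measurable_const_smul γ := (isometry_smul ℍ (γ : PSL(2, ℝ))).continuous.measurable

theorem volume_dirichletDomain_inter_le (F : Set ℍ) :
    volume (X.dirichletDomain ∩ {z | ∃ γ ∈ X.Γ, γ • z ∈ F}) ≤ volume F := by
  refine (measure_mono ?_).trans
    (measure_setOf_exists_smul_mem_inter_le X.isFundamentalDomain_dirichletDomain F)
  rintro z ⟨hz, γ, hγ, h⟩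
  exact ⟨hz, ⟨γ, hγ⟩, h⟩

/-- `t ↦ h • fermi t 0` is the axis of the element `γ` of `Γ`, which translates along it by `l`, and
projects to a simple closed geodesic of length `l`. -/
structure IsSimpleAxis (γ h : PSL(2, ℝ)) (l : ℝ) : Prop where
  mem : γ ∈ X.Γ
  pos : 0 < l
  isTranslation : IsTranslation (h⁻¹ * γ * h) l
  injOn : Set.InjOn (fun t => X.proj (h • fermi t 0)) (Set.Ico 0 l)

/-- The trace on the surface of the geodesic `t ↦ h • fermi t 0`. -/
def trace (h : PSL(2, ℝ)) : Set X.Point := Set.range fun t => X.proj (h • fermi t 0)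

namespace IsSimpleAxis

variable {X} {γ h : PSL(2, ℝ)} {l : ℝ}

theorem smul_smul_fermi (H : X.IsSimpleAxis γ h l) (t s : ℝ) :
    γ • h • fermi t s = h • fermi (t + l) s := by
  rw [← H.isTranslation, mul_smul, mul_smul, smul_inv_smul]

theorem isSimpleClosedGeodesic (H : X.IsSimpleAxis γ h l) :
    X.IsSimpleClosedGeodesic (X.trace h) l := by
  refine ⟨H.pos, fun t => h • fermi t 0, (isometry_smul ℍ h).comp isometry_fermi_zero,
    fun t => ?_, H.injOn, rfl⟩
  exact (congrArg X.proj (H.smul_smul_fermi t 0)).symm.trans (X.proj_smul H.mem _)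

theorem sinh_half_dist_smul (H : X.IsSimpleAxis γ h l) (z : ℍ) :
    ∃ t, sinh (dist z (γ • z) / 2) = cosh (dist z (h • fermi t 0)) * sinh (l / 2) := by
  obtain ⟨w, rfl⟩ := MulAction.surjective h z
  have hdist : dist (h • w) (γ • h • w) = dist w ((h⁻¹ * γ * h) • w) := by
    rw [← dist_smul h w, mul_smul, mul_smul, smul_inv_smul]
  refine ⟨foot w, ?_⟩
  rw [hdist, dist_smul, ← fermi_foot_height w, H.isTranslation.sinh_half_dist_smul H.pos.le,
    cosh_dist_fermi, foot_fermi, sub_self, Real.cosh_zero, Real.sinh_zero, mul_one, mul_one,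
    mul_zero, sub_zero]

theorem le_dist_smul (H : X.IsSimpleAxis γ h l) (z : ℍ) : l ≤ dist z (γ • z) := by
  obtain ⟨t, ht⟩ := H.sinh_half_dist_smul z
  refine (div_le_div_iff_of_pos_right two_pos).1 (Real.sinh_le_sinh.1 ?_)
  rw [ht]
  exact le_mul_of_one_le_left (Real.sinh_nonneg_iff.2 (half_pos H.pos).le) (Real.one_le_cosh _)

theorem exists_cosh_dist_mul_le (H : X.IsSimpleAxis γ h l) (z : ℍ) :
    ∃ t, cosh (dist z (h • fermi t 0)) * l ≤ 2 * sinh (dist z (γ • z) / 2) := by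
  obtain ⟨t, ht⟩ := H.sinh_half_dist_smul z
  refine ⟨t, ?_⟩
  have hsinh : l / 2 ≤ sinh (l / 2) := Real.self_le_sinh_iff.2 (half_pos H.pos).le
  calc cosh (dist z (h • fermi t 0)) * l
      = 2 * (cosh (dist z (h • fermi t 0)) * (l / 2)) := by ring
    _ ≤ 2 * (cosh (dist z (h • fermi t 0)) * sinh (l / 2)) := by gcongr
    _ = 2 * sinh (dist z (γ • z) / 2) := by rw [ht]

theorem exists_smul_mem_strip (H : X.IsSimpleAxis γ h l) {K t : ℝ} {z : ℍ}
    (hz : cosh (dist z (h • fermi t 0)) ≤ K) : ∃ β ∈ X.Γ, h⁻¹ • β • z ∈ strip K l := by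
  have hsinh : |sinh (height (h⁻¹ • z))| ≤ K := by
    rw [← smul_inv_smul h z, dist_smul, ← fermi_foot_height (h⁻¹ • z), cosh_dist_fermi,
      Real.cosh_zero, Real.sinh_zero, mul_one, mul_zero, sub_zero] at hz
    refine (Real.abs_sinh _).trans_le ((Real.sinh_lt_cosh _).le.trans ?_)
    rw [Real.cosh_abs]
    exact (le_mul_of_one_le_right (Real.cosh_pos _).le (Real.one_le_cosh _)).trans hz
  obtain ⟨k, hk⟩ := H.isTranslation.exists_zpow_smul_mem_strip H.pos (t := foot (h⁻¹ • z)) hsinh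
  have hconj : (h⁻¹ * γ * h) ^ k = h⁻¹ * γ ^ k * h := by
    simpa using conj_zpow (a := h⁻¹) (b := γ) (i := k)
  refine ⟨γ ^ k, X.Γ.zpow_mem H.mem k, ?_⟩
  rwa [fermi_foot_height, hconj, mul_smul, mul_smul, smul_inv_smul] at hk

end IsSimpleAxis

theorem exists_pos_le_of_isSimpleAxis :
    ∃ ε > 0, ∀ γ h l, X.IsSimpleAxis γ h l → ε ≤ l := by
  obtain ⟨ε, hε, hle⟩ := X.exists_pos_le_dist_smul
  refine ⟨ε, hε, fun γ h l H => ?_⟩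
  have hdist : dist (h • fermi 0 0) (γ • h • fermi 0 0) = l := by
    rw [H.smul_smul_fermi, dist_smul, isometry_fermi_zero.dist_eq, Real.dist_eq, zero_add, zero_sub,
      abs_neg, abs_of_pos H.pos]
  have hne : γ ≠ 1 := by
    rintro rfl
    rw [one_smul, dist_self] at hdist
    exact H.pos.ne hdist
  exact hdist ▸ hle γ H.mem hne _

theorem isMinimalTranslation_comap_conj {γ h : PSL(2, ℝ)} {l s₀ : ℝ} (hγ : γ ∈ X.Γ) (hl : 0 < l)
    (hD : IsTranslation (h⁻¹ * γ * h) l)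
    (hmin : ∀ β ∈ X.Γ, β ≠ 1 → dist (h • fermi (-(l / 2)) s₀) (γ • h • fermi (-(l / 2)) s₀) ≤
      dist (h • fermi (-(l / 2)) s₀) (β • h • fermi (-(l / 2)) s₀)) :
    IsMinimalTranslation (X.Γ.comap (MulAut.conj h).toMonoidHom) (h⁻¹ * γ * h) l s₀ where
  mem := by
    change h * (h⁻¹ * γ * h) * h⁻¹ ∈ X.Γ
    rwa [← mul_assoc, mul_inv_cancel_right, mul_inv_cancel_left]
  pos := hl
  isTranslation := hD
  dist_le β hβ hne := by
    have h' := hmin _ hβ (mt conj_eq_one_iff.1 hne)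
    rwa [MulEquiv.coe_toMonoidHom, MulAut.conj_apply, mul_smul, inv_smul_smul, mul_smul, dist_smul,
      ← smul_inv_smul h (γ • h • _), dist_smul, ← mul_smul, ← mul_smul] at h'

theorem eq_one_of_mem_comap_conj_of_smul_eq (h : PSL(2, ℝ)) {β : PSL(2, ℝ)}
    (hβ : β ∈ X.Γ.comap (MulAut.conj h).toMonoidHom) (z : ℍ) (hz : β • z = z) : β = 1 :=
  conj_eq_one_iff.1 (X.free (h * β * h⁻¹) hβ (h • z)
    (by rw [mul_smul, inv_smul_smul, mul_smul, hz]))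

theorem exists_isSimpleAxis {R : ℝ} (hR : 0 < R) {z : ℍ} (hz : X.proj z ∈ X.thinPart R) :
    ∃ γ h l, X.IsSimpleAxis γ h l ∧ dist z (γ • z) < 2 * R := by
  obtain ⟨α, hα, hα_ne, hα_lt⟩ := X.exists_dist_smul_lt_of_mem_thinPart hR hz
  obtain ⟨γ, ⟨hγ, hγ_ne⟩, hmin⟩ := X.exists_min_dist_smul
    (S := {β | β ∈ X.Γ ∧ β ≠ 1}) (fun _ hβ => hβ.1) ⟨α, hα, hα_ne⟩ z z
  obtain ⟨g, rfl⟩ := QuotientGroup.mk_surjective γ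
  obtain ⟨h, l, s₀, hl, hD, rfl⟩ :=
    exists_conj_isTranslation_smul_eq (X.four_lt_sq_trace hγ hγ_ne) z
  have hminimal := X.isMinimalTranslation_comap_conj hγ hl hD fun β hβ hne => hmin β ⟨hβ, hne⟩
  refine ⟨g, h, l, ⟨hγ, hl, hD, fun t₁ ht₁ t₂ ht₂ ht => ?_⟩, (hmin α ⟨hα, hα_ne⟩).trans_lt hα_lt⟩
  obtain ⟨β, hβ, hβ_smul⟩ := X.proj_eq_iff.1 ht.symm
  refine hminimal.eq_of_smul_fermi_zero_eq
    (fun _ => X.eq_one_of_mem_comap_conj_of_smul_eq h) (γ := h⁻¹ * β * h) ?_ ht₁ ht₂ ?_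
  · change h * (h⁻¹ * β * h) * h⁻¹ ∈ X.Γ
    rwa [← mul_assoc, mul_inv_cancel_right, mul_inv_cancel_left]
  · rw [mul_smul, mul_smul, inv_smul_eq_iff, hβ_smul]

/-- The points of `ℍ` moved by less than `2 * R` by an element of `Γ` whose axis projects to the
simple closed geodesic `B`. -/
def collar (R : ℝ) (B : Set X.Point) : Set ℍ :=
  {z | ∃ γ h l, X.IsSimpleAxis γ h l ∧ X.trace h = B ∧ dist z (γ • z) < 2 * R}

theorem exists_smul_mem_strip_of_mem_collar {R l : ℝ} {γ h : PSL(2, ℝ)}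
    (H : X.IsSimpleAxis γ h l)
    (hlt : ∀ γ' h' l', X.IsSimpleAxis γ' h' l' → X.trace h' = X.trace h → l < 2 * l')
    {z : ℍ} (hz : z ∈ X.collar R (X.trace h)) :
    ∃ β ∈ X.Γ, h⁻¹ • β • z ∈ strip (4 * sinh R / l) l := by
  obtain ⟨γ', h', l', H', htrace, hzR⟩ := hz
  obtain ⟨t, ht⟩ := H'.exists_cosh_dist_mul_le z
  obtain ⟨s, hs⟩ : X.proj (h' • fermi t 0) ∈ X.trace h := htrace ▸ ⟨t, rfl⟩
  obtain ⟨β, hβ, hβ_smul⟩ := X.proj_eq_iff.1 hs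
  have hcosh : cosh (dist (β • z) (h • fermi s 0)) ≤ 4 * sinh R / l := by
    rw [← hβ_smul, dist_smul, le_div_iff₀ H.pos]
    calc cosh (dist z (h' • fermi t 0)) * l ≤ cosh (dist z (h' • fermi t 0)) * (2 * l') := by
          gcongr
          exact (hlt _ _ _ H' htrace).le
      _ ≤ 2 * (2 * sinh (dist z (γ' • z) / 2)) := by linarith
      _ ≤ 2 * (2 * sinh R) := by
          gcongr
          exact Real.sinh_le_sinh.2 (by linarith)
      _ = 4 * sinh R := by ring
  obtain ⟨α, hα, hmem⟩ := H.exists_smul_mem_strip hcosh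
  exact ⟨α * β, X.Γ.mul_mem hα hβ, mul_smul α β z ▸ hmem⟩

theorem volume_dirichletDomain_inter_collar_le {R : ℝ} (hR : 0 < R) (B : Set X.Point) :
    volume (X.dirichletDomain ∩ X.collar R B) ≤ ENNReal.ofReal (8 * sinh R) := by
  rcases (X.collar R B).eq_empty_or_nonempty with hempty | ⟨z₀, γ₀, h₀, l₀, H₀, hB₀, -⟩
  · rw [hempty, Set.inter_empty, measure_empty]
    exact zero_le
  obtain ⟨ε, hε, hle⟩ := X.exists_pos_le_of_isSimpleAxis
  obtain ⟨l, ⟨γ, h, H, rfl⟩, hlt⟩ := exists_mem_forall_lt_two_mul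
    (A := {l | ∃ γ h, X.IsSimpleAxis γ h l ∧ X.trace h = B}) ⟨l₀, γ₀, h₀, H₀, hB₀⟩ hε
    fun l ⟨γ, h, H, _⟩ => hle γ h l H
  set K := 4 * sinh R / l
  have hK : 0 ≤ K := div_nonneg (by linarith [Real.sinh_pos_iff.2 hR]) H.pos.le
  calc volume (X.dirichletDomain ∩ X.collar R (X.trace h))
      ≤ volume (X.dirichletDomain ∩ {z | ∃ β ∈ X.Γ, β • z ∈ (h⁻¹ • ·) ⁻¹' strip K l}) :=
        measure_mono (Set.inter_subset_inter_right _ fun z =>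
          X.exists_smul_mem_strip_of_mem_collar H fun γ' h' l' H' htrace =>
            hlt l' ⟨γ', h', H', htrace⟩)
    _ ≤ volume ((h⁻¹ • ·) ⁻¹' strip K l) := X.volume_dirichletDomain_inter_le _
    _ = volume (strip K l) :=
        SMulInvariantMeasure.measure_preimage_smul h⁻¹ (measurableSet_strip K l)
    _ = ENNReal.ofReal (2 * K * l) := volume_strip hK H.pos.le
    _ = ENNReal.ofReal (8 * sinh R) := by
        rw [mul_assoc, div_mul_cancel₀ _ H.pos.ne', ← mul_assoc]
        norm_num

theorem vol_thinPart_le {R : ℝ} (hR : 0 < R) : X.vol (X.thinPart R) ≤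
    (X.numSimpleClosedGeodesics (2 * R) : ℝ≥0∞) * ENNReal.ofReal (8 * sinh R) := by
  have hpos : ENNReal.ofReal (8 * sinh R) ≠ 0 :=
    (ENNReal.ofReal_pos.2 (by linarith [Real.sinh_pos_iff.2 hR])).ne'
  refine (measure_mono fun z hz => ?_).trans (measure_biUnion_le_encard_mul volume hpos
    fun B _ => X.volume_dirichletDomain_inter_collar_le hR B)
  obtain ⟨γ, h, l, H, hlt⟩ := X.exists_isSimpleAxis hR hz.2
  exact Set.mem_biUnion ⟨l, (H.le_dist_smul z).trans hlt.le, H.isSimpleClosedGeodesic⟩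
    ⟨hz.1, γ, h, l, H, rfl, hlt⟩

end ClosedHyperbolicSurface

end

theorem mainTheorem3 (X : ℕ → ClosedHyperbolicSurface)
    (hX : ∀ R : ℝ, 0 < R →
      Tendsto (fun n => ((X n).numSimpleClosedGeodesics R : ℝ≥0∞) / (X n).vol Set.univ)
        atTop (𝓝 0)) :
    BenjaminiSchrammConvergent X := by
  intro R hR
  have hbound (n : ℕ) : (X n).vol ((X n).thinPart R) / (X n).vol Set.univ ≤
      (X n).numSimpleClosedGeodesics (2 * R) / (X n).vol Set.univ *
        ENNReal.ofReal (8 * Real.sinh R) :=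
    (ENNReal.div_le_div_right ((X n).vol_thinPart_le hR) _).trans_eq
      (ENNReal.mul_div_right_comm ..)
  have hlim := ENNReal.Tendsto.mul_const (hX (2 * R) (by positivity))
    (Or.inr (ENNReal.ofReal_ne_top (r := 8 * Real.sinh R)))
  rw [zero_mul] at hlim
  exact tendsto_of_tendsto_of_tendsto_of_le_of_le tendsto_const_nhds hlim (fun _ => zero_le) hbound
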